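/- A dessin is a $2$-cell embedding of a connected bipartite graph (with at least one edge, and with coloured vertices) in a closed oriented surface. It is given by its finite nonempty set $E$ of edges and the two permutations $\rho,\lambda$ of $E$ which rotate the edges around their black and around their white end vertices; the group $\langle\rho,\lambda\rangle$ is transitive on $E$. Isomorphisms of dessins are bijections of the edge sets that intertwine the permutations $\rho$ and the permutations $\lambda$, and $\mathrm{Aut}(D)$ is the group of automorphisms of $D$. A dessin $D$ is regular if $\mathrm{Aut}(D)$ is transitive on $E$. Let $F_2=\langle X,Y\mid -\rangle$ be the free group of rank two. A dessin corresponds to the transitive representation $F_2\to\mathrm{Sym}(E)$, $X\mapsto\rho$, $Y\mapsto\lambda$, and each $\sigma\in\mathrm{Aut}(F_2)$ defines a dessin operation $D\mapsto D^\sigma$ by composing this representation with $\sigma^{-1}$. A regular dessin $D$ is totally symmetric if $D^\sigma\cong D$ for all $\sigma\in\mathrm{Aut}(F_2)$. Put $[g,h]=g^{-1}h^{-1}gh$. For a prime $p$ and $a,b,c\ge 1$, and for words $x,y$ with $$z:=[x,y],\qquad u:=[z,x],\qquad v:=[z,y],$$ let $R_p(a,b,c)$ denote the relations $$x^{p^a}=y^{p^a}=z^{p^b}=u^{p^c}=v^{p^c}=[x,u]=[x,v]=[y,u]=[y,v]=1.$$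 **Theorem.** Let $D$ be a totally symmetric dessin whose automorphism group $G=\mathrm{Aut}(D)$ is a $p$-group ($p$ prime) of nilpotency class three. Then $G$ is isomorphic to one of the following groups, for the same prime $p$: (i) $p>3$ and $1\le c\le b\le a$: $\ \langle x,y\mid R_p(a,b,c)\rangle$. (ii) $p=3$ and $1\le c<b=a$ or $1\le c\le b\le a-1$: $\ \langle x,y\mid R_3(a,b,c)\rangle$. (iii) $p=2$ and $1\le c\le b\le a-1$: $\ \langle x,y\mid R_2(a,b,c)\rangle$. (iv) $p=2$ and $1\le c\le b\le a-2$: $\ \langle x,y\mid R_2(a,b,c),\ x^{2^{a-1}}=u^{2^{c-1}},\ y^{2^{a-1}}=v^{2^{c-1}}\rangle$. (v) $p=2$ and $1\le c\le a-2$: $\ \langle x,y\mid R_2(a,a-1,c),\ x^{2^{a-1}}=z^{2^{a-2}},\ y^{2^{a-1}}=z^{2^{a-2}}\rangle$. (vi) $p=2$ and $1\le c\le a-2$: $\ \langle x,y\mid R_2(a,a-1,c),\ x^{2^{a-1}}=z^{2^{a-2}}u^{2^{c-1}},\ y^{2^{a-1}}=z^{2^{a-2}}v^{2^{c-1}}\rangle$.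 Moreover, each of these groups underlies a unique regular dessin: for each group $G$ in the list there is, up to isomorphism, exactly one regular dessin $D$ with $\mathrm{Aut}(D)\cong G$; and $\mathrm{Aut}(G)$ acts transitively on the generating pairs of $G$. Groups from different families, or from the same family with different parameters ($p,a,b,c$ in (i); $a,b,c$ in (ii)-(iv); $a,c$ in (v), (vi)), are not isomorphic. -/

import Mathlib

universe u

/-- The free group `F₂` on the two letters `X = 0` and `Y = 1`. -/
abbrev F2 : Type := FreeGroup (Fin 2)

/-- The monodromy representation `F₂ → Sym(E)`, `X ↦ ρ`, `Y ↦ lam`, of a pair of permutations. -/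
def monodromy {E : Type u} (ρ lam : Equiv.Perm E) : F2 →* Equiv.Perm E :=
  FreeGroup.lift ![ρ, lam]

/-- A dessin, given by its nonempty finite set `E` of edges and the two permutations `ρ`, `lam`
that rotate the edges, following the orientation of the surface, around their black and around
their white end vertices. Connectedness of the bipartite graph is transitivity of the group
generated by `ρ` and `lam`. -/
structure Dessin where
  E : Type u
  finite_edges : Finite E
  nonempty_edges : Nonempty E
  ρ : Equiv.Perm E
  lam : Equiv.Perm E
  transitive : ∀ e e' : E, ∃ w : F2, monodromy ρ lam w e = e'

namespace Dessin

/-- Isomorphism of dessins: a bijection between the edge sets that intertwines the rotations at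
the black vertices and the rotations at the white vertices. -/
def IsIso (D D' : Dessin.{u}) : Prop :=
  ∃ f : D.E ≃ D'.E, (∀ e, f (D.ρ e) = D'.ρ (f e)) ∧ (∀ e, f (D.lam e) = D'.lam (f e))

/-- The automorphism group of a dessin: the permutations of the edges that commute with both
rotations. -/
def Aut (D : Dessin.{u}) : Subgroup (Equiv.Perm D.E) where
  carrier := {g | (∀ e, g (D.ρ e) = D.ρ (g e)) ∧ (∀ e, g (D.lam e) = D.lam (g e))}
  mul_mem' := by
    rintro g h ⟨hg, hg'⟩ ⟨hh, hh'⟩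
    exact ⟨fun e => by simp [hh, hg], fun e => by simp [hh', hg']⟩
  one_mem' := ⟨fun _ => rfl, fun _ => rfl⟩
  inv_mem' := by
    rintro g ⟨hg, hg'⟩
    refine ⟨fun e => ?_, fun e => ?_⟩
    · rw [Equiv.Perm.inv_eq_iff_eq, hg]; simp
    · rw [Equiv.Perm.inv_eq_iff_eq, hg']; simp

/-- A dessin is regular if its automorphism group is transitive on the edges. -/
def IsRegular (D : Dessin.{u}) : Prop :=
  ∀ e e' : D.E, ∃ g ∈ D.Aut, g e = e'

theorem monodromy_comp {E : Type u} (ρ lam : Equiv.Perm E) (σ : F2 ≃* F2) (w : F2) :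
    monodromy (monodromy ρ lam (σ.symm (FreeGroup.of 0)))
      (monodromy ρ lam (σ.symm (FreeGroup.of 1))) w = monodromy ρ lam (σ.symm w) := by
  have h : monodromy (monodromy ρ lam (σ.symm (FreeGroup.of 0)))
      (monodromy ρ lam (σ.symm (FreeGroup.of 1)))
      = (monodromy ρ lam).comp σ.symm.toMonoidHom := by
    apply FreeGroup.ext_hom
    intro i
    fin_cases i <;> simp [monodromy]
  rw [h]; rfl

/-- The dessin operation induced by an automorphism `σ` of `F₂`: the monodromy representation is
composed with `σ⁻¹`, so that the stabilizer `N` of an edge in `F₂` is replaced by `σ(N)`. -/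
def op (σ : F2 ≃* F2) (D : Dessin.{u}) : Dessin.{u} where
  E := D.E
  finite_edges := D.finite_edges
  nonempty_edges := D.nonempty_edges
  ρ := monodromy D.ρ D.lam (σ.symm (FreeGroup.of 0))
  lam := monodromy D.ρ D.lam (σ.symm (FreeGroup.of 1))
  transitive := fun e e' => by
    obtain ⟨w, hw⟩ := D.transitive e e'
    exact ⟨σ w, by rw [monodromy_comp, MulEquiv.symm_apply_apply, hw]⟩

/-- A totally symmetric dessin: a regular dessin which is invariant, up to isomorphism, under all
dessin operations. -/
def IsTotallySymmetric (D : Dessin.{u}) : Prop :=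
  D.IsRegular ∧ ∀ σ : F2 ≃* F2, (D.op σ).IsIso D

end Dessin

/-- The commutator `[g, h] = g⁻¹ h⁻¹ g h`. -/
def grpComm {G : Type u} [Group G] (g h : G) : G := g⁻¹ * h⁻¹ * g * h

namespace DessinGroup

def x : F2 := FreeGroup.of 0
def y : F2 := FreeGroup.of 1
/-- `z = [x, y]` -/
def z : F2 := grpComm x y
/-- `u = [z, x]` -/
def u : F2 := grpComm z x
/-- `v = [z, y]` -/
def v : F2 := grpComm z y

/-- The relators common to all families. -/
def baseRels (p a b c : ℕ) : Set F2 :=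
  {x ^ p ^ a, y ^ p ^ a, z ^ p ^ b, u ^ p ^ c, v ^ p ^ c,
    grpComm x u, grpComm x v, grpComm y u, grpComm y v}

/-- The six families, with their parameters and the conditions on the parameters. -/
inductive Index : Type
  | famI (p a b c : ℕ) (hp : p.Prime) (hp3 : 3 < p) (hc : 1 ≤ c) (hcb : c ≤ b) (hba : b ≤ a)
  | famII (a b c : ℕ) (h : (1 ≤ c ∧ c < b ∧ b = a) ∨ (1 ≤ c ∧ c ≤ b ∧ b + 1 ≤ a))
  | famIII (a b c : ℕ) (hc : 1 ≤ c) (hcb : c ≤ b) (hba : b + 1 ≤ a)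
  | famIV (a b c : ℕ) (hc : 1 ≤ c) (hcb : c ≤ b) (hba : b + 2 ≤ a)
  | famV (a c : ℕ) (hc : 1 ≤ c) (hca : c + 2 ≤ a)
  | famVI (a c : ℕ) (hc : 1 ≤ c) (hca : c + 2 ≤ a)

namespace Index

/-- The prime `p` to which a member of the six families belongs. -/
def prime : Index → ℕ
  | famI p _ _ _ _ _ _ _ _ => p
  | famII _ _ _ _ => 3
  | famIII _ _ _ _ _ _ => 2
  | famIV _ _ _ _ _ _ => 2
  | famV _ _ _ _ => 2
  | famVI _ _ _ _ => 2

/-- The defining relators of a member of the six families; a relation `r = s` is the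
relator `r * s⁻¹`. -/
def rels : Index → Set F2
  | famI p a b c _ _ _ _ _ => baseRels p a b c
  | famII a b c _ => baseRels 3 a b c
  | famIII a b c _ _ _ => baseRels 2 a b c
  | famIV a b c _ _ _ => baseRels 2 a b c ∪
      {x ^ 2 ^ (a - 1) * (u ^ 2 ^ (c - 1))⁻¹,
        y ^ 2 ^ (a - 1) * (v ^ 2 ^ (c - 1))⁻¹}
  | famV a c _ _ => baseRels 2 a (a - 1) c ∪
      {x ^ 2 ^ (a - 1) * (z ^ 2 ^ (a - 2))⁻¹,
        y ^ 2 ^ (a - 1) * (z ^ 2 ^ (a - 2))⁻¹}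
  | famVI a c _ _ => baseRels 2 a (a - 1) c ∪
      {x ^ 2 ^ (a - 1) * (z ^ 2 ^ (a - 2) * u ^ 2 ^ (c - 1))⁻¹,
        y ^ 2 ^ (a - 1) * (z ^ 2 ^ (a - 2) * v ^ 2 ^ (c - 1))⁻¹}

/-- The two-generator group presented by these relators. -/
abbrev Grp (k : Index) : Type := PresentedGroup k.rels

end Index

end DessinGroup

/-!
A regular dessin `D` is the same as the normal subgroup `N` of `F₂` acting trivially on its edges,
and `Aut D ≅ F₂ / N`; it is totally symmetric exactly if `N` is invariant under `Aut F₂`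
(`Dessin.IsRegular.exists_hom`, `Dessin.IsRegular.isIso_of_ker`). For class three everything takes
place in the free nilpotent group `F₂ / γ₄(F₂)`, which is realized as `ℤ⁵` with the multiplication
of collected words `X ^ i * Y ^ j * Z ^ k * U ^ l * V ^ m` (`FreeNilThree`). A pair `x`, `y` in a
group for which `u` and `v` commute with `x` and `y` defines a homomorphism from `FreeNilThree`
(`ClassThree.hom`), so that all commutator calculus becomes polynomial arithmetic with integers.

The six families have a uniform description: with `n = p ^ α` the order of `x` in the
abelianization, the relations are `x ^ n = z ^ κ * u ^ μ`, `y ^ n = z ^ κ * v ^ μ` and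
`z ^ B = u ^ C = v ^ C = 1`, where `κ` is `0` or `B / 2` and `μ` is `0` or `C / 2`
(`PowerRel`, `PowerParams`). The formula for `n`-th powers shows that every generating pair
satisfies the same relations: the correction terms contain `n`, `n choose 2` and `n choose 3`,
and for `p = 2` the determinant of a generating pair in the abelianization is odd
(`PowerRel.hom_pair`, `DessinGroup.Index.odd_det`). As the groups are finite, this gives
the transitivity of the automorphism group on generating pairs, and with it the uniqueness of the
dessin. The words that become trivial form an explicit normal subgroup of `FreeNilThree`
(`DessinGroup.Index.hom_gen_eq_one_iff`), from which the parameters can be read off. Since an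
isomorphism may be assumed to match the distinguished generators, different members of the families
are not isomorphic.

Conversely, let `N` be invariant. Substituting `(X, YX)`, `(Y, X)`, `(X⁻¹, Y)`, `(X, Y⁻¹)` and
`(XY, Y)` for `(X, Y)` shows that the relations inside the derived subgroup are generated by powers
of `Z`, `U` and `V`, that `x ^ n z ^ k u ^ l = 1` for some `k` and `l` with
`z ^ (2k) = u ^ (2l) = 1`, and that `z ^ (n choose 2) = z ^ k` and
`u ^ (n choose 2) = u ^ (n choose 3) = 1`
(`SymmetricPair.exists_power_relation`). These conditions are the restrictions on the parameters
(`SymmetricPair.exists_params`).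
-/

/-! ### Triangular numbers over the integers -/

theorem dvd_trans_eq {a b c : ℤ} (h : a ∣ b) (e : b = c) : a ∣ c := e ▸ h

/-- The binomial coefficient `i choose 2`, for an integer `i`. -/
def tri (i : ℤ) : ℤ := i * (i - 1) / 2

theorem two_mul_tri (i : ℤ) : 2 * tri i = i * (i - 1) :=
  Int.mul_ediv_cancel' (by
    rcases Int.even_or_odd' i with ⟨r, rfl | rfl⟩
    · exact ⟨r * (2 * r - 1), by ring⟩
    · exact ⟨(2 * r + 1) * r, by ring⟩)

theorem tri_add (i j : ℤ) : tri (i + j) = tri i + tri j + i * j := by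
  linarith [two_mul_tri (i + j), two_mul_tri i, two_mul_tri j,
    show (i + j) * (i + j - 1) = i * (i - 1) + j * (j - 1) + 2 * (i * j) by ring]

theorem tri_neg (i : ℤ) : tri (-i) = tri i + i := by
  linarith [two_mul_tri (-i), two_mul_tri i, show -i * (-i - 1) = i * (i - 1) + 2 * i by ring]

theorem tri_mul (i j : ℤ) : tri (i * j) = j * j * tri i + i * tri j := by
  have h : 2 * (j * j * tri i + i * tri j) = i * j * (i * j - 1) := by
    linear_combination j * j * two_mul_tri i + i * two_mul_tri j
  linarith [two_mul_tri (i * j)]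

theorem tri_zero : tri 0 = 0 := rfl

theorem tri_one : tri 1 = 0 := rfl

theorem tri_natCast (n : ℕ) : tri n = n.choose 2 := by
  induction n with
  | zero => rfl
  | succ n ih =>
    push_cast
    rw [tri_add, ih, tri_one, Nat.choose_succ_succ' n 1, Nat.choose_one_right]
    push_cast
    ring

/-! ### Commutators -/

theorem map_grpComm {G H : Type*} [Group G] [Group H] (f : G →* H) (g h : G) :
    f (grpComm g h) = grpComm (f g) (f h) := by
  simp [grpComm]

theorem mul_comm_grpComm {G : Type*} [Group G] (g h : G) : g * h = h * g * grpComm g h := by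
  simp [grpComm, mul_assoc]

theorem grpComm_eq_one_iff {G : Type*} [Group G] {g h : G} : grpComm g h = 1 ↔ Commute g h := by
  rw [grpComm, mul_assoc, mul_eq_one_iff_eq_inv, mul_inv_rev]
  constructor
  · intro e
    rw [← inv_inj, mul_inv_rev, mul_inv_rev, inv_inv, inv_inv] at e
    exact e.symm
  · intro e
    rw [← mul_inv_rev, ← mul_inv_rev, e.eq]

theorem grpComm_eq_one_of_commGroup {A : Type*} [CommGroup A] (x y : A) : grpComm x y = 1 :=
  grpComm_eq_one_iff.2 (Commute.all _ _)

theorem grpComm_mem_commutator {G : Type*} [Group G] {H K : Subgroup G} {g h : G} (hg : g ∈ H)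
    (hh : h ∈ K) : grpComm g h ∈ ⁅H, K⁆ := by
  have := Subgroup.commutator_mem_commutator (inv_mem hg) (inv_mem hh)
  simpa [commutatorElement_def, grpComm] using this

/-! ### The free nilpotent group of class three and rank two -/

/-- The free nilpotent group of class three on two generators `X` and `Y`. The element
`⟨i, j, k, l, m⟩` stands for the collected word `X ^ i * Y ^ j * Z ^ k * U ^ l * V ^ m` in
the basic commutators `Z = [X, Y]`, `U = [Z, X]` and `V = [Z, Y]`. -/
@[ext]
structure FreeNilThree where
  i : ℤ
  j : ℤ
  k : ℤ
  l : ℤ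
  m : ℤ

namespace FreeNilThree

instance : Mul FreeNilThree :=
  ⟨fun g h => ⟨g.i + h.i, g.j + h.j, g.k + h.k - h.i * g.j,
    g.l + h.l + g.k * h.i - g.j * tri h.i,
    g.m + h.m + g.k * h.j - h.i * tri g.j - h.i * g.j * h.j⟩⟩

instance : One FreeNilThree := ⟨⟨0, 0, 0, 0, 0⟩⟩

instance : Inv FreeNilThree :=
  ⟨fun g => ⟨-g.i, -g.j, -g.k - g.i * g.j, -g.l + (g.k + g.i * g.j) * g.i - g.j * tri g.i,
    -g.m + (g.k + g.i * g.j) * g.j + g.i * tri (-g.j) - g.i * g.j * g.j⟩⟩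

theorem mul_def (g h : FreeNilThree) :
    g * h = ⟨g.i + h.i, g.j + h.j, g.k + h.k - h.i * g.j,
      g.l + h.l + g.k * h.i - g.j * tri h.i,
      g.m + h.m + g.k * h.j - h.i * tri g.j - h.i * g.j * h.j⟩ := rfl

theorem one_def : (1 : FreeNilThree) = ⟨0, 0, 0, 0, 0⟩ := rfl

instance : Group FreeNilThree :=
  Group.ofLeftAxioms
    (fun a b c => by
      ext <;> simp only [mul_def, tri_add] <;> ring)
    (fun a => by
      ext <;> simp [mul_def, one_def, tri_zero])
    (fun a => by
      change (⟨_, _, _, _, _⟩ : FreeNilThree) * a = 1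
      ext <;> simp only [mul_def, one_def, tri_neg] <;> ring)

theorem inv_def (g : FreeNilThree) :
    g⁻¹ = ⟨-g.i, -g.j, -g.k - g.i * g.j, -g.l + (g.k + g.i * g.j) * g.i - g.j * tri g.i,
    -g.m + (g.k + g.i * g.j) * g.j + g.i * tri (-g.j) - g.i * g.j * g.j⟩ := rfl

/-- The first generator. -/
def X : FreeNilThree := ⟨1, 0, 0, 0, 0⟩

/-- The second generator. -/
def Y : FreeNilThree := ⟨0, 1, 0, 0, 0⟩

/-- The power formula. All coordinates of `g ^ n` are combinations of `n`, `n choose 2` and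
`n choose 3`; the divisibility of these by powers of `p` separates the families. -/
theorem pow_def (g : FreeNilThree) (n : ℕ) :
    g ^ n = ⟨n * g.i, n * g.j, n * g.k - g.i * g.j * n.choose 2,
      n * g.l + (g.i * g.k - g.j * tri g.i) * n.choose 2 - g.i ^ 2 * g.j * n.choose 3,
      n * g.m + (g.j * g.k - g.i * tri g.j - g.i * g.j ^ 2) * n.choose 2
        - 2 * g.i * g.j ^ 2 * n.choose 3⟩ := by
  induction n with
  | zero => ext <;> simp [one_def]
  | succ n ih =>
    rw [pow_succ, ih, mul_def, Nat.choose_succ_succ' n 2, Nat.choose_succ_succ' n 1,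
      Nat.choose_one_right]
    have h := tri_mul n g.j
    have h2 := two_mul_tri n
    rw [tri_natCast] at h h2
    ext <;> simp only [h] <;> push_cast
    · ring
    · ring
    · ring
    · ring
    · ring

/-- Powers are taken coordinatewise if `i = 0` and one of `j` and `k` vanishes. -/
theorem zpow_of_i_eq_zero (j k l m : ℤ) (hjk : j * k = 0) (s : ℤ) :
    (⟨0, j, k, l, m⟩ : FreeNilThree) ^ s = ⟨0, s * j, s * k, s * l, s * m⟩ := by
  have h (n : ℕ) : (⟨0, j, k, l, m⟩ : FreeNilThree) ^ n = ⟨0, n * j, n * k, n * l, n * m⟩ := by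
    rw [pow_def]
    ext <;> simp [hjk, tri_zero]
  cases s with
  | ofNat n => simpa using h n
  | negSucc n =>
    rw [zpow_negSucc, h, inv_def, Int.negSucc_eq]
    ext <;> push_cast
    · ring
    · ring
    · simp only [tri_zero]; ring
    · linear_combination (n + 1 : ℤ) ^ 2 * hjk

theorem X_zpow (s : ℤ) : X ^ s = ⟨s, 0, 0, 0, 0⟩ := by
  have h (n : ℕ) : X ^ n = ⟨n, 0, 0, 0, 0⟩ := by
    rw [pow_def]
    ext <;> simp [X, tri_zero]
  cases s with
  | ofNat n => simpa using h n
  | negSucc n =>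
    rw [zpow_negSucc, h, inv_def, Int.negSucc_eq]
    ext <;> push_cast <;> simp [tri_zero]

theorem Y_zpow (s : ℤ) : Y ^ s = ⟨0, s, 0, 0, 0⟩ := by
  rw [Y, zpow_of_i_eq_zero _ _ _ _ (by simp)]
  simp

/-- The commutator of two elements, up to central factors. -/
theorem grpComm_def (g h : FreeNilThree) :
    ∃ l m : ℤ, grpComm g h = ⟨0, 0, g.i * h.j - h.i * g.j, l, m⟩ := by
  refine ⟨(grpComm g h).l, (grpComm g h).m, ?_⟩
  ext <;> simp only [grpComm, mul_def, inv_def] <;> ring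

theorem grpComm_of_derived (k l m : ℤ) (g : FreeNilThree) :
    grpComm ⟨0, 0, k, l, m⟩ g = ⟨0, 0, 0, k * g.i, k * g.j⟩ := by
  ext <;> simp only [grpComm, mul_def, inv_def, tri_zero, tri_neg, neg_zero] <;>
    simp [tri_neg] <;> ring

theorem commute_central (l m : ℤ) (g : FreeNilThree) :
    Commute g (⟨0, 0, 0, l, m⟩ : FreeNilThree) := by
  ext <;> simp only [mul_def, tri_zero] <;> ring

theorem eq_collected (i j k l m : ℤ) :
    (⟨i, j, k, l, m⟩ : FreeNilThree) = X ^ i * Y ^ j * grpComm X Y ^ k *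
      grpComm (grpComm X Y) X ^ l * grpComm (grpComm X Y) Y ^ m := by
  have hz : grpComm X Y = ⟨0, 0, 1, 0, 0⟩ := rfl
  have hu : grpComm (grpComm X Y) X = ⟨0, 0, 0, 1, 0⟩ := rfl
  have hv : grpComm (grpComm X Y) Y = ⟨0, 0, 0, 0, 1⟩ := rfl
  rw [hu, hv, hz, X_zpow, Y_zpow, zpow_of_i_eq_zero _ _ _ _ (by simp),
    zpow_of_i_eq_zero _ _ _ _ (by simp), zpow_of_i_eq_zero _ _ _ _ (by simp)]
  ext <;> simp [mul_def, tri_zero]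

theorem closure_X_Y : Subgroup.closure {X, Y} = ⊤ := by
  refine (Subgroup.eq_top_iff' _).2 fun g => ?_
  have hX : X ∈ Subgroup.closure {X, Y} := Subgroup.subset_closure (by simp)
  have hY : Y ∈ Subgroup.closure {X, Y} := Subgroup.subset_closure (by simp)
  have hc {a b : FreeNilThree} (ha : a ∈ Subgroup.closure {X, Y})
      (hb : b ∈ Subgroup.closure {X, Y}) : grpComm a b ∈ Subgroup.closure {X, Y} :=
    mul_mem (mul_mem (mul_mem (inv_mem ha) (inv_mem hb)) ha) hb
  have hZ := hc hX hY
  obtain ⟨i, j, k, l, m⟩ := g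
  rw [eq_collected]
  exact mul_mem (mul_mem (mul_mem (mul_mem (zpow_mem hX _) (zpow_mem hY _)) (zpow_mem hZ _))
    (zpow_mem (hc hZ hX) _)) (zpow_mem (hc hZ hY) _)

end FreeNilThree

/-- The commutation relations of class three for a pair of elements: the two basic commutators of
weight three commute with both elements. -/
structure ClassThree {G : Type*} [Group G] (x y : G) : Prop where
  xu : Commute x (grpComm (grpComm x y) x)
  xv : Commute x (grpComm (grpComm x y) y)
  yu : Commute y (grpComm (grpComm x y) x)
  yv : Commute y (grpComm (grpComm x y) y)

namespace ClassThree

variable {G : Type*} [Group G] {x y : G}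

theorem commute_grpComm {w : G} (hx : Commute x w) (hy : Commute y w) :
    Commute (grpComm x y) w :=
  ((hx.inv_left.mul_left hy.inv_left).mul_left hx).mul_left hy

theorem zu (h : ClassThree x y) : Commute (grpComm x y) (grpComm (grpComm x y) x) :=
  commute_grpComm h.xu h.yu

theorem zv (h : ClassThree x y) : Commute (grpComm x y) (grpComm (grpComm x y) y) :=
  commute_grpComm h.xv h.yv

theorem uv (h : ClassThree x y) :
    Commute (grpComm (grpComm x y) x) (grpComm (grpComm x y) y) :=
  commute_grpComm h.zv h.xv

/-- The value of a collected word at a pair of elements of a group. -/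
def eval (x y : G) (g : FreeNilThree) : G :=
  x ^ g.i * y ^ g.j * grpComm x y ^ g.k * grpComm (grpComm x y) x ^ g.l *
    grpComm (grpComm x y) y ^ g.m

/-- Moving an element `w` to the left through a power of `g`, when `[g, w]` commutes with `g`. -/
theorem zpow_mul_eq {g w : G} (h : Commute g (grpComm g w)) (s : ℤ) :
    g ^ s * w = w * (g ^ s * grpComm g w ^ s) := by
  have h1 : SemiconjBy w (g * grpComm g w) g := by
    rw [SemiconjBy, mul_comm_grpComm g w, mul_assoc]
  rw [← h.mul_zpow]
  exact (h1.zpow_right s).symm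

theorem mul_inv_zpow (h : ClassThree x y) (s : ℤ) :
    (y * (grpComm x y)⁻¹) ^ s =
      y ^ s * grpComm x y ^ (-s) * grpComm (grpComm x y) y ^ (-tri s) := by
  set z := grpComm x y with hz
  set v := grpComm z y with hv
  have step (s : ℤ) : y ^ (s + 1) * z ^ (-(s + 1)) * v ^ (-tri (s + 1)) =
      y ^ s * z ^ (-s) * v ^ (-tri s) * (y * z⁻¹) := by
    have h1 : v ^ (-tri s) * y = y * v ^ (-tri s) := (h.yv.zpow_right _).symm
    have h2 : z ^ (-s) * y = y * (z ^ (-s) * v ^ (-s)) := zpow_mul_eq h.zv _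
    have h3 : v ^ (-tri (s + 1)) * z = z * v ^ (-tri (s + 1)) := (h.zv.zpow_right _).symm
    rw [← mul_assoc, eq_mul_inv_iff_mul_eq, mul_assoc, h3, mul_assoc _ _ y, h1, ← mul_assoc,
      ← mul_assoc, mul_assoc _ _ y, h2, tri_add, tri_one]
    simp only [← mul_assoc]
    rw [mul_assoc _ (v ^ _) (v ^ _), ← zpow_add, ← zpow_add_one, mul_assoc _ _ z,
      ← zpow_add_one]
    congr 3 <;> ring
  induction s with
  | zero => simp [tri_zero]
  | succ n ih => rw [zpow_add_one, ih, step]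
  | pred n ih =>
    have := step (-n - 1)
    rw [sub_add_cancel, ← ih] at this
    rw [zpow_sub_one, this, mul_inv_cancel_right]

/-- Evaluation is compatible with multiplication by the generator `Y`. -/
theorem eval_mul_Y (h : ClassThree x y) (g : FreeNilThree) :
    eval x y (g * FreeNilThree.Y) = eval x y g * y := by
  obtain ⟨i, j, k, l, m⟩ := g
  have e : (⟨i, j, k, l, m⟩ * FreeNilThree.Y : FreeNilThree) = ⟨i, j + 1, k, l, m + k⟩ := by
    ext <;> simp [FreeNilThree.mul_def, FreeNilThree.Y, tri_zero]
  rw [e]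
  simp only [eval]
  rw [mul_assoc _ _ y, ← (h.yv.zpow_right m).eq, ← mul_assoc, mul_assoc _ _ y,
    ← (h.yu.zpow_right l).eq, ← mul_assoc, mul_assoc _ _ y, zpow_mul_eq h.zv k]
  simp only [← mul_assoc]
  rw [← (h.uv.zpow_zpow l k).right_comm, zpow_add_one, add_comm m, zpow_add]
  simp only [← mul_assoc]

/-- Evaluation is compatible with multiplication by the generator `X`. -/
theorem eval_mul_X (h : ClassThree x y) (g : FreeNilThree) :
    eval x y (g * FreeNilThree.X) = eval x y g * x := by
  obtain ⟨i, j, k, l, m⟩ := g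
  have e : (⟨i, j, k, l, m⟩ * FreeNilThree.X : FreeNilThree) =
      ⟨i + 1, j, -j + k, k + l, -tri j + m⟩ := by
    ext <;> simp [FreeNilThree.mul_def, FreeNilThree.X, tri_one] <;> ring
  have hy : SemiconjBy x (y * (grpComm x y)⁻¹) y := by
    rw [SemiconjBy, ← mul_assoc, mul_comm_grpComm x y, mul_inv_cancel_right]
  rw [e]
  simp only [eval]
  rw [mul_assoc _ _ x, ← (h.xv.zpow_right m).eq, ← mul_assoc, mul_assoc _ _ x,
    ← (h.xu.zpow_right l).eq, ← mul_assoc, mul_assoc _ _ x, zpow_mul_eq h.zu k,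
    ← mul_assoc, mul_assoc _ _ x, ← (hy.zpow_right j).eq, h.mul_inv_zpow]
  simp only [← mul_assoc, zpow_add, zpow_one]
  rw [← (h.zv.zpow_zpow k (-tri j)).right_comm, ← (h.uv.zpow_zpow k (-tri j)).right_comm,
    ← (h.uv.zpow_zpow l (-tri j)).right_comm]

/-- The homomorphism from the free nilpotent group of class three which is determined by a pair
of elements satisfying the commutation relations of class three. -/
def hom (h : ClassThree x y) : FreeNilThree →* G where
  toFun := eval x y
  map_one' := by simp [eval, FreeNilThree.one_def]
  map_mul' := by
    intro a b
    have hb : b ∈ Subgroup.closure {FreeNilThree.X, FreeNilThree.Y} := by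
      rw [FreeNilThree.closure_X_Y]; trivial
    induction hb using Subgroup.closure_induction_right generalizing a with
    | one => rw [mul_one]; simp [eval, FreeNilThree.one_def]
    | mul_right b hb c hc ih =>
      rcases hc with rfl | rfl
      · rw [← mul_assoc, h.eval_mul_X, ih, h.eval_mul_X, mul_assoc]
      · rw [← mul_assoc, h.eval_mul_Y, ih, h.eval_mul_Y, mul_assoc]
    | mul_inv_cancel b hb c hc ih =>
      rcases hc with rfl | rfl
      · have h1 := h.eval_mul_X (a * (b * FreeNilThree.X⁻¹))
        have h2 := h.eval_mul_X (b * FreeNilThree.X⁻¹)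
        rw [mul_assoc, inv_mul_cancel_right, ih] at h1
        rw [inv_mul_cancel_right] at h2
        rw [h2, ← mul_assoc] at h1
        exact (mul_right_cancel h1).symm
      · have h1 := h.eval_mul_Y (a * (b * FreeNilThree.Y⁻¹))
        have h2 := h.eval_mul_Y (b * FreeNilThree.Y⁻¹)
        rw [mul_assoc, inv_mul_cancel_right, ih] at h1
        rw [inv_mul_cancel_right] at h2
        rw [h2, ← mul_assoc] at h1
        exact (mul_right_cancel h1).symm

theorem hom_mk (h : ClassThree x y) (i j k l m : ℤ) :
    h.hom ⟨i, j, k, l, m⟩ = x ^ i * y ^ j * grpComm x y ^ k * grpComm (grpComm x y) x ^ l *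
      grpComm (grpComm x y) y ^ m := rfl

theorem hom_X (h : ClassThree x y) : h.hom FreeNilThree.X = x := by
  simp [FreeNilThree.X, hom_mk]

theorem hom_Y (h : ClassThree x y) : h.hom FreeNilThree.Y = y := by
  simp [FreeNilThree.Y, hom_mk]

theorem hom_surjective (h : ClassThree x y) (hxy : Subgroup.closure {x, y} = ⊤) :
    Function.Surjective h.hom := by
  rw [← MonoidHom.range_eq_top, eq_top_iff, ← hxy, Subgroup.closure_le]
  rintro _ (rfl | rfl)
  exacts [⟨_, h.hom_X⟩, ⟨_, h.hom_Y⟩]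

end ClassThree

namespace FreeNilThree

theorem classThree (g h : FreeNilThree) : ClassThree g h := by
  obtain ⟨l, m, e⟩ := grpComm_def g h
  constructor <;> rw [e, grpComm_of_derived] <;> exact commute_central _ _ _

theorem hom_ext {G : Type*} [Group G] {f f' : FreeNilThree →* G} (hX : f X = f' X)
    (hY : f Y = f' Y) : f = f' :=
  MonoidHom.eq_of_eqOn_dense closure_X_Y (by rintro _ (rfl | rfl) <;> assumption)

end FreeNilThree

/-! ### Power relations -/

theorem ClassThree.map {G H : Type*} [Group G] [Group H] {x y : G} (h : ClassThree x y)
    (f : G →* H) : ClassThree (f x) (f y) := by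
  constructor <;> simp only [← map_grpComm]
  exacts [h.xu.map f, h.xv.map f, h.yu.map f, h.yv.map f]

/-- The pair `x`, `y` satisfies the relations of class three together with
`x ^ n = z ^ κ * u ^ μ`, `y ^ n = z ^ κ * v ^ μ` and `z ^ B = u ^ C = v ^ C = 1`, where
`z = [x, y]`, `u = [z, x]` and `v = [z, y]`. -/
structure PowerRel (n B C κ μ : ℕ) {G : Type*} [Group G] (x y : G) : Prop
    extends ClassThree x y where
  z_pow : grpComm x y ^ B = 1
  u_pow : grpComm (grpComm x y) x ^ C = 1
  v_pow : grpComm (grpComm x y) y ^ C = 1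
  x_pow : x ^ n = grpComm x y ^ κ * grpComm (grpComm x y) x ^ μ
  y_pow : y ^ n = grpComm x y ^ κ * grpComm (grpComm x y) y ^ μ

/-- The divisibilities under which the relations `PowerRel` are consistent, and inherited by all
generating pairs: the binomial coefficients are those of the formula for `n`-th powers. -/
structure Admissible (n B C κ μ : ℕ) : Prop where
  n_ne_zero : n ≠ 0
  C_dvd_B : (C : ℤ) ∣ B
  B_dvd_n : (B : ℤ) ∣ n
  C_dvd_κ : (C : ℤ) ∣ κ
  B_dvd_two_mul_κ : (B : ℤ) ∣ 2 * κ
  C_dvd_two_mul_μ : (C : ℤ) ∣ 2 * μ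
  C_dvd_choose_two : (C : ℤ) ∣ n.choose 2
  C_dvd_choose_three : (C : ℤ) ∣ n.choose 3
  B_dvd_choose_two_add : (B : ℤ) ∣ n.choose 2 + κ

/-- The collected words that are consequences of the power relations: `s` and `t` count the
occurrences of the relations for `x ^ n` and for `y ^ n`. -/
def IsRelation (n B C κ μ : ℕ) (g : FreeNilThree) : Prop :=
  ∃ s t : ℤ, g.i = n * s ∧ g.j = n * t ∧ (B : ℤ) ∣ g.k + κ * (s + t) ∧
    (C : ℤ) ∣ g.l + μ * s ∧ (C : ℤ) ∣ g.m + μ * t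

namespace PowerRel

variable {n B C κ μ : ℕ} {G : Type*} [Group G] {x y : G}

theorem hom_eq_one (h : PowerRel n B C κ μ x y) {g : FreeNilThree}
    (hg : IsRelation n B C κ μ g) : h.hom g = 1 := by
  obtain ⟨i, j, k, l, m⟩ := g
  obtain ⟨s, t, hi, hj, hk, hl, hm⟩ := hg
  dsimp only at hi hj hk hl hm
  have hx : x ^ (n * s : ℤ) = h.hom ⟨0, 0, κ * s, μ * s, 0⟩ := by
    rw [zpow_mul, zpow_natCast, h.x_pow, ((h.zu.pow_pow _ _).mul_zpow s), h.hom_mk, zpow_mul,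
      zpow_mul]
    simp
  have hy : y ^ (n * t : ℤ) = h.hom ⟨0, 0, κ * t, 0, μ * t⟩ := by
    rw [zpow_mul, zpow_natCast, h.y_pow, ((h.zv.pow_pow _ _).mul_zpow t), h.hom_mk, zpow_mul,
      zpow_mul]
    simp
  have e : h.hom ⟨i, j, k, l, m⟩ = x ^ i * y ^ j * h.hom ⟨0, 0, k, l, m⟩ := by
    simp [ClassThree.hom_mk, mul_assoc]
  have e2 : (⟨0, 0, κ * s, μ * s, 0⟩ * ⟨0, 0, κ * t, 0, μ * t⟩ * ⟨0, 0, k, l, m⟩ : FreeNilThree) =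
      ⟨0, 0, k + κ * (s + t), l + μ * s, m + μ * t⟩ := by
    ext <;> simp only [FreeNilThree.mul_def, tri_zero] <;> ring
  rw [e, hi, hj, hx, hy, ← map_mul, ← map_mul, e2, h.hom_mk]
  obtain ⟨k', hk⟩ := hk
  obtain ⟨l', hl⟩ := hl
  obtain ⟨m', hm⟩ := hm
  rw [hk, hl, hm]
  simp only [zpow_mul, zpow_natCast, h.z_pow, h.u_pow, h.v_pow]
  simp

/-- The relation for `n`-th powers holds for an arbitrary element in place of `x`, where `D`, `L`
and `M` are the exponents of a commutator with a second element. -/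
theorem hom_pow_eq (A : Admissible n B C κ μ) (h : PowerRel n B C κ μ x y)
    (a : FreeNilThree) (D L M : ℤ)
    (hD : (κ = 0 ∧ μ = 0) ∨ (Odd D ∧ (Odd a.i ∨ Odd a.j))) :
    h.hom a ^ n = h.hom ⟨0, 0, D, L, M⟩ ^ κ * h.hom ⟨0, 0, 0, D * a.i, D * a.j⟩ ^ μ := by
  -- As `n choose 2` is congruent to `-κ` modulo `B`, the exponent of `z` in `a ^ n` is determined
  -- by the parity of `i * j + i + j`, which is odd unless `i` and `j` are both even.
  have hκ : (B : ℤ) ∣ κ * (a.i * a.j + a.i + a.j - D) := by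
    rcases hD with ⟨rfl, rfl⟩ | ⟨⟨d, hd⟩, ho⟩
    · simp
    · have : (2 : ℤ) ∣ a.i * a.j + a.i + a.j - D := by
        rcases ho with ⟨r, hr⟩ | ⟨r, hr⟩
        · exact ⟨r * a.j + a.j + r - d, by rw [hr, hd]; ring⟩
        · exact ⟨a.i * r + a.i + r - d, by rw [hr, hd]; ring⟩
      obtain ⟨w, hw⟩ := this
      rw [hw, ← mul_assoc, mul_comm (κ : ℤ)]
      exact A.B_dvd_two_mul_κ.mul_right _
  have hμ : (C : ℤ) ∣ μ * (1 - D) := by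
    rcases hD with ⟨rfl, rfl⟩ | ⟨⟨d, hd⟩, ho⟩
    · simp
    · have : (μ : ℤ) * (1 - D) = 2 * μ * (-d) := by rw [hd]; ring
      rw [this]
      exact A.C_dvd_two_mul_μ.mul_right _
  have hn : (C : ℤ) ∣ n := A.C_dvd_B.trans A.B_dvd_n
  rw [← map_pow, ← map_pow, ← map_pow, ← map_mul, ← mul_inv_eq_one, ← map_inv, ← map_mul]
  apply h.hom_eq_one
  have e : (⟨0, 0, D, L, M⟩ ^ κ * ⟨0, 0, 0, D * a.i, D * a.j⟩ ^ μ : FreeNilThree)⁻¹ =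
      ⟨0, 0, -(κ * D), -(κ * L + μ * (D * a.i)), -(κ * M + μ * (D * a.j))⟩ := by
    rw [← zpow_natCast, ← zpow_natCast, FreeNilThree.zpow_of_i_eq_zero _ _ _ _ (by simp),
      FreeNilThree.zpow_of_i_eq_zero _ _ _ _ (by simp)]
    ext <;> simp [FreeNilThree.mul_def, FreeNilThree.inv_def, tri_zero]
  rw [e, FreeNilThree.pow_def, FreeNilThree.mul_def]
  refine ⟨a.i, a.j, ?_, ?_, ?_, ?_, ?_⟩ <;> simp only [tri_zero]
  · ring
  · ring
  · have : n * a.k - a.i * a.j * n.choose 2 + -(κ * D) - 0 * (n * a.j) + κ * (a.i + a.j) =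
        n * a.k - a.i * a.j * (n.choose 2 + κ) + κ * (a.i * a.j + a.i + a.j - D) := by ring
    rw [this]
    exact ((A.B_dvd_n.mul_right _).sub (A.B_dvd_choose_two_add.mul_left _)).add hκ
  · refine dvd_trans_eq ((((((hn.mul_right a.l).add
      (A.C_dvd_choose_two.mul_left (a.i * a.k - a.j * tri a.i))).sub
      (A.C_dvd_choose_three.mul_left (a.i ^ 2 * a.j))).sub (A.C_dvd_κ.mul_right L)).add
      (hμ.mul_right a.i))) ?_
    ring
  · refine dvd_trans_eq ((((((hn.mul_right a.m).add
      (A.C_dvd_choose_two.mul_left (a.j * a.k - a.i * tri a.j - a.i * a.j ^ 2))).sub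
      (A.C_dvd_choose_three.mul_left (2 * a.i * a.j ^ 2))).sub (A.C_dvd_κ.mul_right M)).add
      (hμ.mul_right a.j))) ?_
    ring

/-- The power relations are inherited by every pair of elements if `κ = μ = 0`, and otherwise by
every pair whose determinant in the abelianization is odd. -/
theorem hom_pair (A : Admissible n B C κ μ) (h : PowerRel n B C κ μ x y)
    (a b : FreeNilThree) (hD : (κ = 0 ∧ μ = 0) ∨ Odd (a.i * b.j - b.i * a.j)) :
    PowerRel n B C κ μ (h.hom a) (h.hom b) := by
  obtain ⟨L, M, e⟩ := FreeNilThree.grpComm_def a b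
  set D := a.i * b.j - b.i * a.j with hDdef
  have hz : grpComm (h.hom a) (h.hom b) = h.hom ⟨0, 0, D, L, M⟩ := by rw [← map_grpComm, e]
  have hw (c : FreeNilThree) : grpComm (grpComm (h.hom a) (h.hom b)) (h.hom c) =
      h.hom ⟨0, 0, 0, D * c.i, D * c.j⟩ := by
    rw [hz, ← map_grpComm, FreeNilThree.grpComm_of_derived]
  have hpow {k l m : ℤ} {N : ℕ} (hk : (B : ℤ) ∣ N * k) (hC : (C : ℤ) ∣ N) :
      h.hom ⟨0, 0, k, l, m⟩ ^ N = 1 := by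
    rw [← map_pow, ← zpow_natCast, FreeNilThree.zpow_of_i_eq_zero _ _ _ _ (by simp)]
    refine h.hom_eq_one ⟨0, 0, by simp, by simp, by simpa using hk, ?_, ?_⟩ <;>
      simpa using hC.mul_right _
  refine ⟨(a.classThree b).map h.hom, ?_, ?_, ?_, ?_, ?_⟩
  · rw [hz]
    exact hpow (dvd_mul_right _ _) A.C_dvd_B
  · rw [hw]
    exact hpow (by simp) dvd_rfl
  · rw [hw]
    exact hpow (by simp) dvd_rfl
  · rw [hw, hz]
    refine h.hom_pow_eq A a D L M (hD.imp_right fun ho => ⟨ho, ?_⟩)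
    by_contra! hc
    simp only [Int.not_odd_iff_even] at hc
    exact Int.not_even_iff_odd.2 ho ((hc.1.mul_right _).sub (hc.2.mul_left _))
  · rw [hw, hz]
    refine h.hom_pow_eq A b D L M (hD.imp_right fun ho => ⟨ho, ?_⟩)
    by_contra! hc
    simp only [Int.not_odd_iff_even] at hc
    exact Int.not_even_iff_odd.2 ho ((hc.2.mul_left _).sub (hc.1.mul_right _))

theorem finite (A : Admissible n B C κ μ) (h : PowerRel n B C κ μ x y)
    (hxy : Subgroup.closure {x, y} = ⊤) : Finite G := by
  have hB : 0 < B := Nat.pos_of_ne_zero fun h0 => A.n_ne_zero (by simpa [h0] using A.B_dvd_n)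
  have hC : 0 < C := Nat.pos_of_ne_zero fun h0 => hB.ne' (by simpa [h0] using A.C_dvd_B)
  have fz : IsOfFinOrder (grpComm x y) := isOfFinOrder_iff_pow_eq_one.2 ⟨B, hB, h.z_pow⟩
  have fu : IsOfFinOrder (grpComm (grpComm x y) x) :=
    isOfFinOrder_iff_pow_eq_one.2 ⟨C, hC, h.u_pow⟩
  have fv : IsOfFinOrder (grpComm (grpComm x y) y) :=
    isOfFinOrder_iff_pow_eq_one.2 ⟨C, hC, h.v_pow⟩
  have fx : IsOfFinOrder x := by
    refine IsOfFinOrder.of_pow (n := n) ?_ A.n_ne_zero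
    rw [h.x_pow]
    exact (h.zu.pow_pow _ _).isOfFinOrder_mul fz.pow fu.pow
  have fy : IsOfFinOrder y := by
    refine IsOfFinOrder.of_pow (n := n) ?_ A.n_ne_zero
    rw [h.y_pow]
    exact (h.zv.pow_pow _ _).isOfFinOrder_mul fz.pow fv.pow
  have := fx.finite_zpowers.to_subtype
  have := fy.finite_zpowers.to_subtype
  have := fz.finite_zpowers.to_subtype
  have := fu.finite_zpowers.to_subtype
  have := fv.finite_zpowers.to_subtype
  refine Finite.of_surjective
    (fun q : Subgroup.zpowers x × Subgroup.zpowers y × Subgroup.zpowers (grpComm x y) ×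
      Subgroup.zpowers (grpComm (grpComm x y) x) × Subgroup.zpowers (grpComm (grpComm x y) y) =>
      (q.1 * q.2.1 * q.2.2.1 * q.2.2.2.1 * q.2.2.2.2 : G)) fun g => ?_
  obtain ⟨⟨i, j, k, l, m⟩, rfl⟩ := h.hom_surjective hxy g
  exact ⟨⟨⟨x ^ i, i, rfl⟩, ⟨y ^ j, j, rfl⟩, ⟨_ ^ k, k, rfl⟩, ⟨_ ^ l, l, rfl⟩, ⟨_ ^ m, m, rfl⟩⟩, rfl⟩

end PowerRel

/-! ### The group defined by the power relations -/

theorem isRelation_mul {n B C κ μ : ℕ} (A : Admissible n B C κ μ) {a b : FreeNilThree}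
    (ha : IsRelation n B C κ μ a) (hb : IsRelation n B C κ μ b) :
    IsRelation n B C κ μ (a * b) := by
  obtain ⟨s, t, hi, hj, hk, hl, hm⟩ := ha
  obtain ⟨s', t', hi', hj', hk', hl', hm'⟩ := hb
  have hn : (C : ℤ) ∣ n := A.C_dvd_B.trans A.B_dvd_n
  refine ⟨s + s', t + t', ?_, ?_, ?_, ?_, ?_⟩ <;>
    simp only [FreeNilThree.mul_def, hi, hj, hi', hj']
  · ring
  · ring
  · refine dvd_trans_eq ((hk.add hk').sub (A.B_dvd_n.mul_right (s' * (n * t)))) ?_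
    ring
  · refine dvd_trans_eq ((hl.add hl').add (hn.mul_right (a.k * s' - t * tri (n * s')))) ?_
    ring
  · refine dvd_trans_eq ((hm.add hm').add
      (hn.mul_right (a.k * t' - s' * tri (n * t) - s' * (n * t) * (n * t')))) ?_
    ring

theorem isRelation_inv {n B C κ μ : ℕ} (A : Admissible n B C κ μ) {a : FreeNilThree}
    (ha : IsRelation n B C κ μ a) : IsRelation n B C κ μ a⁻¹ := by
  obtain ⟨s, t, hi, hj, hk, hl, hm⟩ := ha
  have hn : (C : ℤ) ∣ n := A.C_dvd_B.trans A.B_dvd_n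
  refine ⟨-s, -t, ?_, ?_, ?_, ?_, ?_⟩ <;> simp only [FreeNilThree.inv_def, hi, hj]
  · ring
  · ring
  · refine dvd_trans_eq (hk.neg_right.sub (A.B_dvd_n.mul_right (s * (n * t)))) ?_
    ring
  · refine dvd_trans_eq (hl.neg_right.add
      (hn.mul_right ((a.k + n * s * (n * t)) * s - t * tri (n * s)))) ?_
    ring
  · refine dvd_trans_eq (hm.neg_right.add (hn.mul_right ((a.k + n * s * (n * t)) * t
      + s * tri (-(n * t)) - s * (n * t) * (n * t)))) ?_
    ring

theorem isRelation_conj {n B C κ μ : ℕ} (A : Admissible n B C κ μ) {a : FreeNilThree}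
    (ha : IsRelation n B C κ μ a) (h : FreeNilThree) :
    IsRelation n B C κ μ (h * a * h⁻¹) := by
  obtain ⟨s, t, hi, hj, hk, hl, hm⟩ := ha
  have hn : (C : ℤ) ∣ n := A.C_dvd_B.trans A.B_dvd_n
  have htri (r : ℤ) : (C : ℤ) ∣ tri (n * r) := by
    rw [tri_mul, tri_natCast]
    exact (A.C_dvd_choose_two.mul_left _).add (hn.mul_right _)
  -- The coordinate `a.k` is divisible by `C`, since `κ` is.
  have hak : (C : ℤ) ∣ a.k := by
    have := (A.C_dvd_B.trans hk).sub (A.C_dvd_κ.mul_right (s + t))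
    rwa [add_sub_cancel_right] at this
  have e : h * a * h⁻¹ = ⟨a.i, a.j, a.k - a.i * h.j + h.i * a.j,
      a.l + h.k * a.i - h.j * tri a.i - (a.k - a.i * h.j + h.i * a.j) * h.i + a.j * tri h.i,
      a.m + h.k * a.j - a.i * tri h.j - a.i * h.j * a.j
        - (a.k - a.i * h.j + h.i * a.j) * h.j + h.i * tri a.j + h.i * a.j * h.j⟩ := by
    rw [mul_inv_eq_iff_eq_mul]
    ext <;> simp only [FreeNilThree.mul_def] <;> ring
  rw [e]
  refine ⟨s, t, hi, hj, ?_, ?_, ?_⟩ <;> simp only [hi, hj]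
  · refine dvd_trans_eq (hk.add (A.B_dvd_n.mul_right (h.i * t - h.j * s))) ?_
    ring
  · refine dvd_trans_eq (((hl.add (hn.mul_right
      (h.k * s + s * h.j * h.i - h.i * t * h.i + t * tri h.i))).sub
      (hak.mul_right h.i)).sub ((htri s).mul_left h.j)) ?_
    ring
  · refine dvd_trans_eq (((hm.add (hn.mul_right
      (h.k * t - s * tri h.j - s * h.j * (n * t) + s * h.j * h.j))).sub
      (hak.mul_right h.j)).add ((htri t).mul_left h.i)) ?_
    ring

/-- The normal subgroup of the free nilpotent group of class three that consists of the
consequences of the power relations. -/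
def relationSubgroup {n B C κ μ : ℕ} (A : Admissible n B C κ μ) : Subgroup FreeNilThree where
  carrier := {g | IsRelation n B C κ μ g}
  mul_mem' := isRelation_mul A
  one_mem' := ⟨0, 0, by simp [FreeNilThree.one_def]⟩
  inv_mem' := isRelation_inv A

instance {n B C κ μ : ℕ} (A : Admissible n B C κ μ) : (relationSubgroup A).Normal :=
  ⟨fun _ ha h => isRelation_conj A ha h⟩

/-- The power relations hold in the quotient by the relation subgroup; so this quotient is a model
of the group which they define. -/
theorem powerRel_quotient {n B C κ μ : ℕ} (A : Admissible n B C κ μ) :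
    PowerRel n B C κ μ (FreeNilThree.X : FreeNilThree ⧸ relationSubgroup A)
      (FreeNilThree.Y : FreeNilThree ⧸ relationSubgroup A) := by
  set q := QuotientGroup.mk' (relationSubgroup A) with hq
  have hz : grpComm (q FreeNilThree.X) (q FreeNilThree.Y) = q ⟨0, 0, 1, 0, 0⟩ := by
    rw [← map_grpComm]; rfl
  have hu : grpComm (grpComm (q FreeNilThree.X) (q FreeNilThree.Y)) (q FreeNilThree.X) =
      q ⟨0, 0, 0, 1, 0⟩ := by
    rw [hz, ← map_grpComm]; rfl
  have hv : grpComm (grpComm (q FreeNilThree.X) (q FreeNilThree.Y)) (q FreeNilThree.Y) =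
      q ⟨0, 0, 0, 0, 1⟩ := by
    rw [hz, ← map_grpComm]; rfl
  have hone (g : FreeNilThree) : q g = 1 ↔ IsRelation n B C κ μ g :=
    QuotientGroup.eq_one_iff g
  have hpow (j k l m : ℤ) (h : j * k = 0) (s : ℕ) :
      (⟨0, j, k, l, m⟩ : FreeNilThree) ^ s = ⟨0, s * j, s * k, s * l, s * m⟩ := by
    rw [← zpow_natCast, FreeNilThree.zpow_of_i_eq_zero _ _ _ _ h]
  have hX (s : ℕ) : FreeNilThree.X ^ s = ⟨s, 0, 0, 0, 0⟩ := by
    rw [← zpow_natCast, FreeNilThree.X_zpow]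
  have hY (s : ℕ) : FreeNilThree.Y ^ s = ⟨0, s, 0, 0, 0⟩ := by
    rw [← zpow_natCast, FreeNilThree.Y_zpow]
  change PowerRel n B C κ μ (q FreeNilThree.X) (q FreeNilThree.Y)
  refine ⟨(FreeNilThree.classThree _ _).map q, ?_, ?_, ?_, ?_, ?_⟩
  · rw [hz, ← map_pow, hone, hpow _ _ _ _ (by simp)]
    exact ⟨0, 0, by simp⟩
  · rw [hu, ← map_pow, hone, hpow _ _ _ _ (by simp)]
    exact ⟨0, 0, by simp⟩
  · rw [hv, ← map_pow, hone, hpow _ _ _ _ (by simp)]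
    exact ⟨0, 0, by simp⟩
  · rw [hu, hz, ← map_pow, ← map_pow, ← map_pow, ← map_mul, ← mul_inv_eq_one, ← map_inv,
      ← map_mul, hone, hpow _ _ _ _ (by simp), hpow _ _ _ _ (by simp), hX]
    exact ⟨1, 0, by simp [FreeNilThree.mul_def, FreeNilThree.inv_def, tri_zero]⟩
  · rw [hv, hz, ← map_pow, ← map_pow, ← map_pow, ← map_mul, ← mul_inv_eq_one, ← map_inv,
      ← map_mul, hone, hpow _ _ _ _ (by simp), hpow _ _ _ _ (by simp), hY]
    exact ⟨0, 1, by simp [FreeNilThree.mul_def, FreeNilThree.inv_def, tri_zero]⟩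

/-- In a group mapping onto the quotient by the relation subgroup, compatibly with the
generators, exactly the elements of the relation subgroup become trivial. -/
theorem PowerRel.hom_eq_one_iff {n B C κ μ : ℕ} (A : Admissible n B C κ μ) {G : Type*} [Group G]
    {x y : G} (h : PowerRel n B C κ μ x y) (f : G →* FreeNilThree ⧸ relationSubgroup A)
    (hx : f x = (FreeNilThree.X : FreeNilThree ⧸ relationSubgroup A))
    (hy : f y = (FreeNilThree.Y : FreeNilThree ⧸ relationSubgroup A)) (g : FreeNilThree) :
    h.hom g = 1 ↔ IsRelation n B C κ μ g := by
  refine ⟨fun hg => ?_, h.hom_eq_one⟩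
  have e : f.comp h.hom = QuotientGroup.mk' (relationSubgroup A) := by
    apply FreeNilThree.hom_ext
    · simp [ClassThree.hom_X, hx]
    · simp [ClassThree.hom_Y, hy]
  have := DFunLike.congr_fun e g
  rw [MonoidHom.comp_apply, hg, map_one] at this
  exact (QuotientGroup.eq_one_iff g).1 this.symm

/-- The relation subgroup determines the parameters, up to the obvious congruences. -/
theorem relation_params_eq {n B C κ μ n' B' C' κ' μ' : ℕ} (A : Admissible n B C κ μ)
    (A' : Admissible n' B' C' κ' μ')
    (h : ∀ g, IsRelation n B C κ μ g ↔ IsRelation n' B' C' κ' μ' g) :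
    n = n' ∧ B = B' ∧ C = C' ∧ (B : ℤ) ∣ κ' - κ ∧ (C : ℤ) ∣ μ' - μ := by
  have key {n B C κ μ n' B' C' κ' μ' : ℕ} (A' : Admissible n' B' C' κ' μ')
      (h : ∀ g, IsRelation n B C κ μ g → IsRelation n' B' C' κ' μ' g) :
      n' ∣ n ∧ B' ∣ B ∧ C' ∣ C := by
    have h0 := A'.n_ne_zero
    refine ⟨?_, ?_, ?_⟩
    · obtain ⟨s, t, hi, -⟩ := h ⟨n, 0, -κ, -μ, 0⟩ ⟨1, 0, by simp⟩
      exact Int.natCast_dvd_natCast.1 ⟨s, hi⟩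
    · obtain ⟨s, t, hi, hj, hk, -⟩ := h ⟨0, 0, B, 0, 0⟩ ⟨0, 0, by simp⟩
      obtain rfl : s = 0 := by simpa [h0] using hi
      obtain rfl : t = 0 := by simpa [h0] using hj
      simpa [Int.natCast_dvd_natCast] using hk
    · obtain ⟨s, t, hi, hj, -, hl, -⟩ := h ⟨0, 0, 0, C, 0⟩ ⟨0, 0, by simp⟩
      obtain rfl : s = 0 := by simpa [h0] using hi
      simpa [Int.natCast_dvd_natCast] using hl
  obtain ⟨hn, hB, hC⟩ := key A' fun g => (h g).1
  obtain ⟨hn', hB', hC'⟩ := key A fun g => (h g).2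
  obtain rfl := Nat.dvd_antisymm hn hn'
  obtain rfl := Nat.dvd_antisymm hB hB'
  obtain rfl := Nat.dvd_antisymm hC hC'
  have h0 : (n' : ℤ) ≠ 0 := by exact_mod_cast A'.n_ne_zero
  obtain ⟨s, t, hi, hj, hk, hl, -⟩ := (h ⟨n', 0, -κ, -μ, 0⟩).1 ⟨1, 0, by simp⟩
  obtain rfl : s = 1 := mul_left_cancel₀ h0 (by simpa using hi.symm)
  obtain rfl : t = 0 := mul_left_cancel₀ h0 (by simpa using hj.symm)
  refine ⟨rfl, rfl, rfl, dvd_trans_eq hk ?_, dvd_trans_eq hl ?_⟩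
  · simp only; ring
  · simp only; ring

/-! ### The parameters of the six families -/

/-- Uniform parameters for the six families: `p ^ α`, `p ^ b`, `p ^ c` are the orders of `x` modulo
the commutator subgroup, of `z` and of `u`, and
`x ^ p ^ α = z ^ (ε * p ^ (b - 1)) * u ^ (δ * p ^ (c - 1))`. -/
@[ext]
structure PowerParams where
  p : ℕ
  α : ℕ
  b : ℕ
  c : ℕ
  ε : ℕ
  δ : ℕ

namespace PowerParams

/-- The relations `PowerRel` with the given parameters. -/
abbrev Rel (P : PowerParams) {G : Type*} [Group G] (x y : G) : Prop :=
  PowerRel (P.p ^ P.α) (P.p ^ P.b) (P.p ^ P.c) (P.ε * P.p ^ (P.b - 1)) (P.δ * P.p ^ (P.c - 1)) x y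

/-- The conditions on the parameters, uniformly in the six families. -/
structure Valid (P : PowerParams) : Prop where
  prime : P.p.Prime
  one_le_c : 1 ≤ P.c
  c_le_b : P.c ≤ P.b
  b_le_α : P.b ≤ P.α
  ε_le : P.ε ≤ 1
  δ_le : P.δ ≤ 1
  odd : P.p ≠ 2 → P.ε = 0 ∧ P.δ = 0
  three : P.p = 3 → P.c < P.α
  two : P.p = 2 → P.c < P.α ∧ (P.ε = 0 → P.b < P.α) ∧ (P.ε = 1 → P.b = P.α)

end PowerParams

theorem pow_dvd_choose_mul (p α k : ℕ) (hp : p.Prime) :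
    p ^ α ∣ (p ^ α).choose (k + 1) * (k + 1) := by
  obtain ⟨n, hn⟩ := Nat.exists_eq_succ_of_ne_zero (pow_ne_zero α hp.ne_zero)
  rw [hn, Nat.succ_eq_add_one, ← Nat.add_one_mul_choose_eq]
  exact dvd_mul_right _ _

/-- For a prime `q`, the binomial coefficient `p ^ α choose q` is divisible by `p ^ α` if `q ≠ p`,
and by `p ^ (α - 1)` if `q = p`. -/
theorem pow_dvd_choose {p q e α : ℕ} (hp : p.Prime) (hq : q.Prime) (he : e ≤ α)
    (h : p = q → e < α) : p ^ e ∣ (p ^ α).choose q := by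
  have key := pow_dvd_choose_mul p α (q - 1) hp
  rw [Nat.sub_add_cancel hq.one_le] at key
  by_cases hpq : p = q
  · have := (pow_dvd_pow p (h hpq)).trans key
    rw [Nat.succ_eq_add_one, pow_succ, ← hpq] at this
    rw [← hpq]
    exact Nat.dvd_of_mul_dvd_mul_right hp.pos this
  · exact (pow_dvd_pow p he).trans
      ((Nat.Coprime.pow_left α ((Nat.coprime_primes hp hq).2 hpq)).dvd_of_dvd_mul_right key)

theorem PowerParams.Valid.admissible {P : PowerParams} (h : P.Valid) :
    Admissible (P.p ^ P.α) (P.p ^ P.b) (P.p ^ P.c) (P.ε * P.p ^ (P.b - 1))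
      (P.δ * P.p ^ (P.c - 1)) := by
  obtain ⟨p, α, b, c, ε, δ⟩ := P
  obtain ⟨hp, hc, hcb, hba, hε, hδ, ho, h3, h2⟩ := h
  dsimp only at *
  have hpow {e : ℕ} (he : 1 ≤ e) : p ^ e = p * p ^ (e - 1) := by
    rw [← pow_succ', Nat.sub_add_cancel he]
  have hcα := hcb.trans hba
  refine ⟨pow_ne_zero _ hp.ne_zero, ?_, ?_, ?_, ?_, ?_, ?_, ?_, ?_⟩ <;> norm_cast
  · exact pow_dvd_pow p hcb
  · exact pow_dvd_pow p hba
  · by_cases hp2 : p = 2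
    · interval_cases ε
      · simp
      · rw [one_mul]
        have := h2 hp2
        exact pow_dvd_pow p (by omega)
    · simp [(ho hp2).1]
  · by_cases hp2 : p = 2
    · rw [hpow (hc.trans hcb), hp2]
      exact ⟨ε, by ring⟩
    · simp [(ho hp2).1]
  · by_cases hp2 : p = 2
    · rw [hpow hc, hp2]
      exact ⟨δ, by ring⟩
    · simp [(ho hp2).2]
  · exact pow_dvd_choose hp Nat.prime_two hcα fun h => (h2 h).1
  · exact pow_dvd_choose hp Nat.prime_three hcα h3
  · interval_cases ε
    · simpa using pow_dvd_choose hp Nat.prime_two hba fun h => (h2 h).2.1 rfl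
    · obtain rfl : p = 2 := by
        by_contra hp2
        exact absurd (ho hp2).1 one_ne_zero
      obtain rfl := (h2 rfl).2.2 rfl
      rw [hpow (hc.trans hcb)]
      set m := 2 ^ (b - 1)
      refine ⟨m, ?_⟩
      have h1 := two_mul_tri ((2 * m : ℕ) : ℤ)
      rw [tri_natCast] at h1
      zify
      push_cast at h1 ⊢
      linarith

namespace DessinGroup.Index

/-- The uniform parameters of a member of the six families. In the last three families the order
of `x` is `2 ^ a`, and the order of `x` modulo the commutator subgroup is `2 ^ (a - 1)`. -/
def params : Index → PowerParams
  | famI p a b c _ _ _ _ _ => ⟨p, a, b, c, 0, 0⟩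
  | famII a b c _ => ⟨3, a, b, c, 0, 0⟩
  | famIII a b c _ _ _ => ⟨2, a, b, c, 0, 0⟩
  | famIV a b c _ _ _ => ⟨2, a - 1, b, c, 0, 1⟩
  | famV a c _ _ => ⟨2, a - 1, a - 1, c, 1, 0⟩
  | famVI a c _ _ => ⟨2, a - 1, a - 1, c, 1, 1⟩

theorem params_p (k : Index) : k.params.p = k.prime := by
  cases k <;> rfl

theorem params_valid (k : Index) : k.params.Valid := by
  cases k with
  | famI p a b c hp hp3 hc hcb hba =>
    constructor <;> simp [params, hp] <;> omega
  | famII a b c h =>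
    constructor <;> simp [params, Nat.prime_three] <;> omega
  | famIII a b c hc hcb hba =>
    constructor <;> simp [params, Nat.prime_two] <;> omega
  | famIV a b c hc hcb hba =>
    constructor <;> simp [params, Nat.prime_two] <;> omega
  | famV a c hc hca =>
    constructor <;> simp [params, Nat.prime_two] <;> omega
  | famVI a c hc hca =>
    constructor <;> simp [params, Nat.prime_two] <;> omega

theorem exists_params_eq {P : PowerParams} (h : P.Valid) : ∃ k : Index, k.params = P := by
  obtain ⟨p, α, b, c, ε, δ⟩ := P
  obtain ⟨hp, hc, hcb, hba, hε, hδ, ho, h3, h2⟩ := h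
  dsimp only at *
  by_cases hp2 : p = 2
  · obtain rfl := hp2
    obtain ⟨hcα, hε0, hε1⟩ := h2 rfl
    interval_cases ε <;> interval_cases δ
    · exact ⟨famIII α b c hc hcb (hε0 rfl), rfl⟩
    · exact ⟨famIV (α + 1) b c hc hcb (by have := hε0 rfl; omega), rfl⟩
    · obtain rfl := hε1 rfl
      exact ⟨famV (b + 1) c hc (by omega), rfl⟩
    · obtain rfl := hε1 rfl
      exact ⟨famVI (b + 1) c hc (by omega), rfl⟩
  · obtain ⟨rfl, rfl⟩ := ho hp2
    by_cases hp3 : p = 3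
    · obtain rfl := hp3
      have := h3 rfl
      exact ⟨famII α b c (by omega), rfl⟩
    · have := hp.two_le
      exact ⟨famI p α b c hp (by omega) hc hcb hba, rfl⟩

theorem params_injective : Function.Injective params := by
  intro k l h
  cases k <;> cases l <;>
    simp only [params, PowerParams.mk.injEq] at h <;>
    simp only [famI.injEq, famII.injEq, famIII.injEq, famIV.injEq, famV.injEq, famVI.injEq,
      reduceCtorEq] <;> omega

/-- A pair of elements satisfies the defining relations of a member of the six families if and only
if it satisfies the power relations with its uniform parameters. -/
theorem forall_rels_iff (k : Index) {G : Type*} [Group G] (x y : G) :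
    (∀ r ∈ k.rels, FreeGroup.lift ![x, y] r = 1) ↔ k.params.Rel x y := by
  have hx : FreeGroup.lift ![x, y] DessinGroup.x = x := by simp [DessinGroup.x]
  have hy : FreeGroup.lift ![x, y] DessinGroup.y = y := by simp [DessinGroup.y]
  have hz : FreeGroup.lift ![x, y] DessinGroup.z = grpComm x y := by
    rw [DessinGroup.z, map_grpComm, hx, hy]
  have hu : FreeGroup.lift ![x, y] DessinGroup.u = grpComm (grpComm x y) x := by
    rw [DessinGroup.u, map_grpComm, hz, hx]
  have hv : FreeGroup.lift ![x, y] DessinGroup.v = grpComm (grpComm x y) y := by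
    rw [DessinGroup.v, map_grpComm, hz, hy]
  have hbase (p a b c : ℕ) : (∀ r ∈ baseRels p a b c, FreeGroup.lift ![x, y] r = 1) ↔
      x ^ p ^ a = 1 ∧ y ^ p ^ a = 1 ∧ grpComm x y ^ p ^ b = 1 ∧
      grpComm (grpComm x y) x ^ p ^ c = 1 ∧ grpComm (grpComm x y) y ^ p ^ c = 1 ∧
      ClassThree x y := by
    have : ClassThree x y ↔ Commute x (grpComm (grpComm x y) x) ∧
      Commute x (grpComm (grpComm x y) y) ∧ Commute y (grpComm (grpComm x y) x) ∧
      Commute y (grpComm (grpComm x y) y) :=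
      ⟨fun h => ⟨h.1, h.2, h.3, h.4⟩, fun h => ⟨h.1, h.2.1, h.2.2.1, h.2.2.2⟩⟩
    rw [this]
    simp only [baseRels, Set.mem_insert_iff, Set.mem_singleton_iff, forall_eq_or_imp, forall_eq,
      map_pow, map_grpComm, hx, hy, hz, hu, hv, grpComm_eq_one_iff]
  have hpow : k.params.Rel x y →
      x ^ (2 * k.params.p ^ k.params.α) = 1 ∧ y ^ (2 * k.params.p ^ k.params.α) = 1 := by
    intro h
    have A := k.params_valid.admissible
    constructor
    · have := h.hom_eq_one (g := FreeNilThree.X ^ ((2 * k.params.p ^ k.params.α : ℕ) : ℤ)) (by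
        rw [FreeNilThree.X_zpow]
        refine ⟨2, 0, by push_cast; ring, by simp, ?_, ?_, by simp⟩
        · simpa [mul_comm] using A.B_dvd_two_mul_κ
        · simpa [mul_comm] using A.C_dvd_two_mul_μ)
      rwa [zpow_natCast, map_pow, h.hom_X] at this
    · have := h.hom_eq_one (g := FreeNilThree.Y ^ ((2 * k.params.p ^ k.params.α : ℕ) : ℤ)) (by
        rw [FreeNilThree.Y_zpow]
        refine ⟨0, 2, by simp, by push_cast; ring, ?_, by simp, ?_⟩
        · simpa [mul_comm] using A.B_dvd_two_mul_κ
        · simpa [mul_comm] using A.C_dvd_two_mul_μ)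
      rwa [zpow_natCast, map_pow, h.hom_Y] at this
  have hbase0 (p a b c : ℕ) : (∀ r ∈ baseRels p a b c, FreeGroup.lift ![x, y] r = 1) ↔
      PowerParams.Rel ⟨p, a, b, c, 0, 0⟩ x y := by
    rw [hbase]
    exact ⟨fun ⟨h1, h2, h3, h4, h5, h6⟩ => ⟨h6, h3, h4, h5, by simpa using h1, by simpa using h2⟩,
      fun h => ⟨by simpa using h.x_pow, by simpa using h.y_pow, h.z_pow, h.u_pow, h.v_pow,
        h.toClassThree⟩⟩
  -- In the last three families `x ^ 2 ^ a = y ^ 2 ^ a = 1` follows from the other relations.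
  have hext {a b c ε δ : ℕ} (ha : 1 ≤ a) {r s : F2}
      (hk : k.params = ⟨2, a - 1, b, c, ε, δ⟩)
      (hr : FreeGroup.lift ![x, y] r =
        grpComm x y ^ (ε * 2 ^ (b - 1)) * grpComm (grpComm x y) x ^ (δ * 2 ^ (c - 1)))
      (hs : FreeGroup.lift ![x, y] s =
        grpComm x y ^ (ε * 2 ^ (b - 1)) * grpComm (grpComm x y) y ^ (δ * 2 ^ (c - 1))) :
      (∀ w ∈ baseRels 2 a b c ∪ {DessinGroup.x ^ 2 ^ (a - 1) * r⁻¹,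
        DessinGroup.y ^ 2 ^ (a - 1) * s⁻¹}, FreeGroup.lift ![x, y] w = 1) ↔ k.params.Rel x y := by
    have e : 2 * 2 ^ (a - 1) = 2 ^ a := by rw [← pow_succ', Nat.sub_add_cancel ha]
    rw [hk] at hpow ⊢
    simp only [e] at hpow
    simp only [Set.union_insert, Set.union_singleton, Set.mem_insert_iff, forall_eq_or_imp, hbase,
      map_mul, map_inv, map_pow, hx, hy, hr, hs, mul_inv_eq_one]
    exact ⟨fun ⟨h7, h8, h1, h2, h3, h4, h5, h6⟩ => ⟨h6, h3, h4, h5, h7, h8⟩,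
      fun h => ⟨h.x_pow, h.y_pow,
        (hpow h).1, (hpow h).2, h.z_pow, h.u_pow, h.v_pow, h.toClassThree⟩⟩
  cases k with
  | famI p a b c hp hp3 hc hcb hba => exact hbase0 p a b c
  | famII a b c h => exact hbase0 3 a b c
  | famIII a b c hc hcb hba => exact hbase0 2 a b c
  | famIV a b c hc hcb hba =>
    exact hext (by omega) rfl (by simp [hu]) (by simp [hv])
  | famV a c hc hca =>
    exact hext (by omega) rfl (by simp [hz, Nat.sub_sub]) (by simp [hz, Nat.sub_sub])
  | famVI a c hc hca =>
    exact hext (by omega) rfl (by simp [hz, hu, Nat.sub_sub]) (by simp [hz, hv, Nat.sub_sub])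

end DessinGroup.Index

/-! ### Generating pairs and isomorphisms of the groups in the six families -/

theorem PowerRel.of_commGroup {n B C κ μ : ℕ} {A : Type*} [CommGroup A] {x y : A}
    (hx : x ^ n = 1) (hy : y ^ n = 1) : PowerRel n B C κ μ x y := by
  refine ⟨⟨Commute.all _ _, Commute.all _ _, Commute.all _ _, Commute.all _ _⟩, ?_, ?_, ?_, ?_, ?_⟩
    <;> simp [grpComm_eq_one_of_commGroup, hx, hy]

/-- If the determinant of two vectors over the field of two elements vanishes, then both vectors
are annihilated by a nonzero linear form. -/
theorem exists_form_of_det_eq_zero : ∀ i j i' j' : ZMod 2, i * j' - i' * j = 0 →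
    ∃ c d : ZMod 2, (c ≠ 0 ∨ d ≠ 0) ∧ i * c + j * d = 0 ∧ i' * c + j' * d = 0 := by
  decide

namespace DessinGroup.Index

variable (k : Index)

/-- The first generator of a member of the six families. -/
def genX : k.Grp := PresentedGroup.of 0

/-- The second generator of a member of the six families. -/
def genY : k.Grp := PresentedGroup.of 1

theorem rel_gen : k.params.Rel k.genX k.genY := by
  rw [← forall_rels_iff]
  intro r hr
  have e : FreeGroup.lift ![k.genX, k.genY] = PresentedGroup.mk k.rels := by
    apply FreeGroup.ext_hom
    intro i
    fin_cases i <;> simp [genX, genY, PresentedGroup.of]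
  rw [e]
  exact PresentedGroup.one_of_mem hr

theorem closure_gen : Subgroup.closure {k.genX, k.genY} = ⊤ := by
  have h := PresentedGroup.closure_range_of k.rels
  rw [← h]
  congr 1
  ext g
  simp [genX, genY, eq_comm]

instance : Finite k.Grp := k.rel_gen.finite k.params_valid.admissible k.closure_gen

variable {k} in
/-- The homomorphism to a group that sends the generators to a pair satisfying the power
relations. -/
def toGroup {G : Type*} [Group G] {x y : G} (h : k.params.Rel x y) : k.Grp →* G :=
  PresentedGroup.toGroup ((forall_rels_iff k x y).2 h)

variable {k}

theorem toGroup_genX {G : Type*} [Group G] {x y : G} (h : k.params.Rel x y) :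
    toGroup h k.genX = x := by
  simp [toGroup, genX]

theorem toGroup_genY {G : Type*} [Group G] {x y : G} (h : k.params.Rel x y) :
    toGroup h k.genY = y := by
  simp [toGroup, genY]

theorem toGroup_surjective {G : Type*} [Group G] {x y : G} (h : k.params.Rel x y)
    (hxy : Subgroup.closure {x, y} = ⊤) : Function.Surjective (toGroup h) := by
  rw [← MonoidHom.range_eq_top, eq_top_iff, ← hxy, Subgroup.closure_le]
  rintro _ (rfl | rfl)
  exacts [⟨_, toGroup_genX h⟩, ⟨_, toGroup_genY h⟩]

/-- For `p = 2`, a generating pair has odd determinant in the abelianization. -/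
theorem odd_det (hp : k.params.p = 2) {a b : FreeNilThree}
    (h : Subgroup.closure {k.rel_gen.hom a, k.rel_gen.hom b} = ⊤) :
    Odd (a.i * b.j - b.i * a.j) := by
  by_contra hD
  rw [Int.not_odd_iff_even, even_iff_two_dvd] at hD
  have hD' := (ZMod.intCast_zmod_eq_zero_iff_dvd _ 2).2 (by exact_mod_cast hD)
  push_cast at hD'
  obtain ⟨c, d, hcd, ha, hb⟩ := exists_form_of_det_eq_zero _ _ _ _ hD'
  -- The linear form `(i, j) ↦ i * c + j * d` defines a character of the group.
  have hpow (w : ZMod 2) : Multiplicative.ofAdd w ^ k.params.p ^ k.params.α = 1 := by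
    have hα : k.params.α ≠ 0 := by
      have := k.params_valid.one_le_c
      have := k.params_valid.c_le_b
      have := k.params_valid.b_le_α
      omega
    rw [← ofAdd_nsmul, nsmul_eq_mul, hp, Nat.cast_pow, ← ofAdd_zero]
    congr 1
    rw [show ((2 : ℕ) : ZMod 2) = 0 from rfl, zero_pow hα, zero_mul]
  have hrel : k.params.Rel (Multiplicative.ofAdd c) (Multiplicative.ofAdd d) :=
    PowerRel.of_commGroup (hpow c) (hpow d)
  have hval (g : FreeNilThree) : toGroup hrel (k.rel_gen.hom g) =
      Multiplicative.ofAdd (g.i * c + g.j * d : ZMod 2) := by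
    obtain ⟨i, j, l, m, n⟩ := g
    rw [ClassThree.hom_mk]
    simp only [map_mul, map_zpow, map_grpComm, toGroup_genX, toGroup_genY,
      grpComm_eq_one_of_commGroup, one_zpow, mul_one]
    rw [ofAdd_add, ← zsmul_eq_mul, ← zsmul_eq_mul, ofAdd_zsmul, ofAdd_zsmul]
  have htriv : toGroup hrel = 1 := by
    refine MonoidHom.eq_of_eqOn_dense h ?_
    rintro _ (rfl | rfl)
    · rw [hval, ha]; rfl
    · rw [hval, hb]; rfl
  rcases hcd with hc | hd
  · apply hc
    rw [← ofAdd_eq_one, ← toGroup_genX hrel, htriv]; rfl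
  · apply hd
    rw [← ofAdd_eq_one, ← toGroup_genY hrel, htriv]; rfl

/-- Every generating pair of a member of the six families satisfies the defining relations, and
hence is the image of the distinguished pair under an automorphism. -/
theorem exists_mulEquiv_gen {g h : k.Grp} (hgh : Subgroup.closure {g, h} = ⊤) :
    ∃ α : k.Grp ≃* k.Grp, α k.genX = g ∧ α k.genY = h := by
  obtain ⟨a, rfl⟩ := k.rel_gen.hom_surjective k.closure_gen g
  obtain ⟨b, rfl⟩ := k.rel_gen.hom_surjective k.closure_gen h
  have hrel : k.params.Rel (k.rel_gen.hom a) (k.rel_gen.hom b) := by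
    refine k.rel_gen.hom_pair k.params_valid.admissible a b ?_
    by_cases hp : k.params.p = 2
    · exact Or.inr (odd_det hp hgh)
    · obtain ⟨h1, h2⟩ := k.params_valid.odd hp
      exact Or.inl (by simp [h1, h2])
  have hs := toGroup_surjective hrel hgh
  exact ⟨MulEquiv.ofBijective _ ⟨Finite.injective_iff_surjective.2 hs, hs⟩,
    toGroup_genX hrel, toGroup_genY hrel⟩

theorem exists_mulEquiv {g h g' h' : k.Grp} (hgh : Subgroup.closure {g, h} = ⊤)
    (hgh' : Subgroup.closure {g', h'} = ⊤) : ∃ α : k.Grp ≃* k.Grp, α g = g' ∧ α h = h' := by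
  obtain ⟨α, rfl, rfl⟩ := exists_mulEquiv_gen hgh
  obtain ⟨β, rfl, rfl⟩ := exists_mulEquiv_gen hgh'
  exact ⟨α.symm.trans β, by simp, by simp⟩

theorem hom_gen_eq_one_iff (k : Index) (g : FreeNilThree) :
    k.rel_gen.hom g = 1 ↔ IsRelation (k.params.p ^ k.params.α) (k.params.p ^ k.params.b)
      (k.params.p ^ k.params.c) (k.params.ε * k.params.p ^ (k.params.b - 1))
      (k.params.δ * k.params.p ^ (k.params.c - 1)) g := by
  have h := powerRel_quotient k.params_valid.admissible
  exact k.rel_gen.hom_eq_one_iff k.params_valid.admissible (toGroup (k := k) h) (toGroup_genX h)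
    (toGroup_genY h) g

theorem eq_of_dvd_sub {p e ε ε' : ℕ} (hp : p.Prime) (he : 1 ≤ e) (hε : ε ≤ 1) (hε' : ε' ≤ 1)
    (h : ((p ^ e : ℕ) : ℤ) ∣ ((ε' * p ^ (e - 1) : ℕ) : ℤ) - ((ε * p ^ (e - 1) : ℕ) : ℤ)) :
    ε = ε' := by
  have hn : ¬ p ^ e ∣ p ^ (e - 1) := by
    rw [Nat.pow_dvd_pow_iff_le_right hp.one_lt]
    omega
  interval_cases ε <;> interval_cases ε'
  · rfl
  · refine absurd (Int.natCast_dvd_natCast.1 ?_) hn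
    simpa using h
  · refine absurd (Int.natCast_dvd_natCast.1 ?_) hn
    simpa using h
  · rfl

theorem eq_of_mulEquiv {k l : Index} (e : k.Grp ≃* l.Grp) : k = l := by
  have hgen : Subgroup.closure {e k.genX, e k.genY} = ⊤ := by
    have := congrArg (Subgroup.map e.toMonoidHom) k.closure_gen
    rw [MonoidHom.map_closure, Set.image_pair,
      Subgroup.map_top_of_surjective _ e.surjective] at this
    exact this
  -- After an automorphism, the isomorphism matches the distinguished generators.
  obtain ⟨α, hX, hY⟩ := exists_mulEquiv_gen hgen
  have hf : l.rel_gen.hom = (e.trans α.symm).toMonoidHom.comp k.rel_gen.hom := by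
    apply FreeNilThree.hom_ext
    · simp [ClassThree.hom_X, ← hX]
    · simp [ClassThree.hom_Y, ← hY]
  obtain ⟨hn, hB, hC, hκ, hμ⟩ := relation_params_eq k.params_valid.admissible
    l.params_valid.admissible fun g => by
      rw [← hom_gen_eq_one_iff, ← hom_gen_eq_one_iff, hf]
      simp
  have hk := k.params_valid
  have hl := l.params_valid
  have hp : k.params.p = l.params.p := by
    have : k.params.p ∣ l.params.p ^ l.params.c :=
      hC ▸ dvd_pow_self _ (Nat.one_le_iff_ne_zero.1 hk.one_le_c)
    exact (Nat.prime_dvd_prime_iff_eq hk.prime hl.prime).1 (hk.prime.dvd_of_dvd_pow this)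
  rw [← hp] at hn hB hC hκ hμ
  have inj := Nat.pow_right_injective hk.prime.two_le
  have hb := inj hB
  have hc := inj hC
  rw [← hb] at hκ
  rw [← hc] at hμ
  apply params_injective
  ext
  · exact hp
  · exact inj hn
  · exact hb
  · exact hc
  · exact eq_of_dvd_sub hk.prime (hk.one_le_c.trans hk.c_le_b) hk.ε_le hl.ε_le hκ
  · exact eq_of_dvd_sub hk.prime hk.one_le_c hk.δ_le hl.δ_le hμ

end DessinGroup.Index

/-! ### Regular dessins and normal subgroups of the free group -/

namespace Dessin

/-- The monodromy homomorphism of a dessin. -/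
abbrev mono (D : Dessin.{u}) : F2 →* Equiv.Perm D.E := monodromy D.ρ D.lam

theorem mono_of_zero (D : Dessin.{u}) : D.mono (FreeGroup.of 0) = D.ρ := by simp [monodromy]

theorem mono_of_one (D : Dessin.{u}) : D.mono (FreeGroup.of 1) = D.lam := by simp [monodromy]

theorem aut_mono_apply (D : Dessin.{u}) {g : Equiv.Perm D.E} (hg : g ∈ D.Aut) (w : F2) (e : D.E) :
    g (D.mono w e) = D.mono w (g e) := by
  have h : ∀ w : F2, D.mono w ∈ Subgroup.centralizer {g} := by
    intro w
    induction w using FreeGroup.induction_on with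
    | C1 => rw [map_one]; exact one_mem _
    | of i =>
      rw [Subgroup.mem_centralizer_singleton_iff]
      ext e
      fin_cases i
      · simpa [monodromy] using (hg.1 e).symm
      · simpa [monodromy] using (hg.2 e).symm
    | inv_of i h => rw [map_inv]; exact inv_mem h
    | mul a b ha hb => rw [map_mul]; exact mul_mem ha hb
  exact (Equiv.congr_fun (Subgroup.mem_centralizer_singleton_iff.1 (h w)) e).symm

theorem aut_ext (D : Dessin.{u}) {g h : D.Aut} (e : D.E) (he : (g : Equiv.Perm D.E) e = h.1 e) :
    g = h := by
  apply Subtype.ext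
  ext e'
  obtain ⟨w, rfl⟩ := D.transitive e e'
  exact (D.aut_mono_apply g.2 w e).trans ((congrArg _ he).trans (D.aut_mono_apply h.2 w e).symm)

/-- In a regular dessin the monodromy group acts freely on the edges. -/
theorem IsRegular.mono_eq_one {D : Dessin.{u}} (hD : D.IsRegular) {w : F2} {e : D.E}
    (h : D.mono w e = e) : D.mono w = 1 := by
  ext e'
  obtain ⟨g, hg, rfl⟩ := hD e e'
  rw [← D.aut_mono_apply hg, h]
  rfl

/-- The automorphism group of a regular dessin is the quotient of the free group by the kernel of
the monodromy representation. -/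
theorem IsRegular.exists_hom {D : Dessin.{u}} (hD : D.IsRegular) :
    ∃ π : F2 →* D.Aut, Function.Surjective π ∧ ∀ w, π w = 1 ↔ D.mono w = 1 := by
  obtain ⟨e⟩ := D.nonempty_edges
  choose g hg hge using fun w : F2 => hD (D.mono w e) e
  -- The automorphism moving `w e` to `e` depends multiplicatively on `w`.
  refine ⟨⟨⟨fun w => ⟨g w, hg w⟩, ?_⟩, ?_⟩, ?_, ?_⟩
  · apply D.aut_ext (D.mono 1 e)
    simpa using hge 1
  · intro v w
    apply D.aut_ext (D.mono (v * w) e)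
    change g (v * w) _ = g v (g w _)
    rw [hge, map_mul, Equiv.Perm.mul_apply, D.aut_mono_apply (hg w), hge, hge]
  · rintro ⟨h, hh⟩
    obtain ⟨w, hw⟩ := D.transitive (h e) e
    refine ⟨w, D.aut_ext (D.mono w e) ?_⟩
    exact (hge w).trans (hw.symm.trans (D.aut_mono_apply hh w e).symm)
  · intro w
    refine ⟨fun h => hD.mono_eq_one (e := e) ?_, fun h => D.aut_ext e ?_⟩
    · have h1 : g w = 1 := congrArg Subtype.val h
      simpa [h1] using hge w
    · simpa [h] using hge w

theorem IsRegular.isIso_of_ker {D D' : Dessin.{u}} (hD : D.IsRegular) (hD' : D'.IsRegular)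
    (h : ∀ w, D.mono w = 1 ↔ D'.mono w = 1) : D.IsIso D' := by
  obtain ⟨e⟩ := D.nonempty_edges
  obtain ⟨e'⟩ := D'.nonempty_edges
  have key {D : Dessin.{u}} (hD : D.IsRegular) (e : D.E) (v w : F2) :
      D.mono v e = D.mono w e ↔ D.mono (w⁻¹ * v) = 1 := by
    constructor
    · intro hvw
      refine hD.mono_eq_one (e := e) ?_
      rw [map_mul, Equiv.Perm.mul_apply, hvw, map_inv]
      simp
    · intro hvw
      rw [map_mul, map_inv, inv_mul_eq_one] at hvw
      rw [hvw]
  choose s hs using D.transitive e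
  have hf (w : F2) : D'.mono (s (D.mono w e)) e' = D'.mono w e' := by
    rw [key hD', ← h, ← key hD, hs]
  refine ⟨Equiv.ofBijective (fun a => D'.mono (s a) e') ⟨fun a b hab => ?_, fun b => ?_⟩, ?_, ?_⟩
  · dsimp only at hab
    rw [key hD', ← h, ← key hD, hs, hs] at hab
    exact hab
  · obtain ⟨w, rfl⟩ := D'.transitive e' b
    exact ⟨D.mono w e, hf w⟩
  · intro a
    obtain ⟨w, rfl⟩ := D.transitive e a
    have := hf (FreeGroup.of 0 * w)
    rw [map_mul, map_mul, mono_of_zero, mono_of_zero, Equiv.Perm.mul_apply] at this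
    exact this.trans (congrArg D'.ρ (hf w).symm)
  · intro a
    obtain ⟨w, rfl⟩ := D.transitive e a
    have := hf (FreeGroup.of 1 * w)
    rw [map_mul, map_mul, mono_of_one, mono_of_one, Equiv.Perm.mul_apply] at this
    exact this.trans (congrArg D'.lam (hf w).symm)

theorem IsIso.mono_eq_one_iff {D D' : Dessin.{u}} (h : D.IsIso D') (w : F2) :
    D.mono w = 1 ↔ D'.mono w = 1 := by
  obtain ⟨f, hρ, hlam⟩ := h
  have e : D'.mono = f.permCongrHom.toMonoidHom.comp D.mono := by
    apply FreeGroup.ext_hom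
    intro i
    ext a
    fin_cases i
    · simpa [monodromy] using (hρ (f.symm a)).symm
    · simpa [monodromy] using (hlam (f.symm a)).symm
  rw [e]
  exact (map_eq_one_iff f.permCongrHom f.permCongrHom.injective).symm

/-- The left regular action of a group, lifted to an arbitrary universe. -/
def leftMul (G : Type) [Group G] : G →* Equiv.Perm (ULift.{u} G) :=
  Equiv.ulift.symm.permCongrHom.toMonoidHom.comp (MulAction.toPermHom G G)

theorem leftMul_apply {G : Type} [Group G] (g a : G) :
    leftMul.{u} G g ⟨a⟩ = ⟨g * a⟩ := rfl

theorem monodromy_leftMul {G : Type} [Group G] (x y : G) (w : F2) :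
    monodromy (leftMul.{u} G x) (leftMul.{u} G y) w = leftMul G (FreeGroup.lift ![x, y] w) := by
  have e : monodromy (leftMul.{u} G x) (leftMul.{u} G y) =
      (leftMul G).comp (FreeGroup.lift ![x, y]) := by
    apply FreeGroup.ext_hom
    intro i
    fin_cases i <;> simp [monodromy]
  rw [e]
  rfl

/-- The regular dessin whose edges are the elements of a finite group, the rotations being the
left multiplications by two generators. -/
def cayley {G : Type} [Group G] [Finite G] (x y : G)
    (hxy : Function.Surjective (FreeGroup.lift ![x, y] : F2 →* G)) : Dessin.{u} where
  E := ULift.{u} G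
  finite_edges := inferInstance
  nonempty_edges := ⟨⟨1⟩⟩
  ρ := leftMul G x
  lam := leftMul G y
  transitive := by
    rintro ⟨a⟩ ⟨b⟩
    obtain ⟨w, hw⟩ := hxy (b * a⁻¹)
    exact ⟨w, by rw [monodromy_leftMul, hw, leftMul_apply, inv_mul_cancel_right]⟩

section Cayley

variable {G : Type} [Group G] [Finite G] {x y : G}
  (hxy : Function.Surjective (FreeGroup.lift ![x, y] : F2 →* G))

theorem cayley_mono_apply (w : F2) (a : G) :
    (cayley.{u} x y hxy).mono w ⟨a⟩ = ⟨FreeGroup.lift ![x, y] w * a⟩ := by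
  exact Equiv.congr_fun (monodromy_leftMul x y w) ⟨a⟩

theorem cayley_isRegular : (cayley.{u} x y hxy).IsRegular := by
  rintro ⟨a⟩ ⟨b⟩
  refine ⟨(Equiv.ulift.trans (Equiv.mulRight (a⁻¹ * b))).trans Equiv.ulift.symm, ⟨?_, ?_⟩, ?_⟩
  · rintro ⟨c⟩
    exact congrArg ULift.up (mul_assoc _ _ _)
  · rintro ⟨c⟩
    exact congrArg ULift.up (mul_assoc _ _ _)
  · exact congrArg ULift.up (mul_inv_cancel_left _ _)

theorem cayley_mono_eq_one_iff (w : F2) :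
    (cayley.{u} x y hxy).mono w = 1 ↔ FreeGroup.lift ![x, y] w = 1 := by
  constructor
  · intro h
    have := cayley_mono_apply.{u} hxy w 1
    rw [h, mul_one] at this
    exact (congrArg ULift.down this).symm
  · intro h
    ext ⟨a⟩
    rw [cayley_mono_apply, h, one_mul]
    rfl

end Cayley

end Dessin

theorem nonempty_mulEquiv_of_ker {F A B : Type*} [Group F] [Group A] [Group B] (f : F →* A)
    (g : F →* B) (hf : Function.Surjective f) (hg : Function.Surjective g)
    (h : ∀ w, f w = 1 ↔ g w = 1) : Nonempty (A ≃* B) := by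
  have e : f.ker = g.ker := Subgroup.ext h
  exact ⟨(QuotientGroup.quotientKerEquivOfSurjective f hf).symm.trans
    ((QuotientGroup.quotientMulEquivOfEq e).trans
      (QuotientGroup.quotientKerEquivOfSurjective g hg))⟩

theorem closure_image_of {G : Type*} [Group G] {f : F2 →* G} (hf : Function.Surjective f) :
    Subgroup.closure {f (FreeGroup.of 0), f (FreeGroup.of 1)} = ⊤ := by
  have h := congrArg (Subgroup.map f) (FreeGroup.closure_range_of (Fin 2))
  rw [MonoidHom.map_closure, Subgroup.map_top_of_surjective _ hf, ← Set.range_comp] at h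
  rw [← h]
  congr 1
  ext g
  simp [eq_comm]

namespace DessinGroup.Index

theorem lift_gen (k : Index) :
    FreeGroup.lift ![k.genX, k.genY] = PresentedGroup.mk k.rels := by
  apply FreeGroup.ext_hom
  intro i
  fin_cases i <;> simp [genX, genY, PresentedGroup.of]

theorem lift_gen_surjective (k : Index) :
    Function.Surjective (FreeGroup.lift ![k.genX, k.genY] : F2 →* k.Grp) := by
  rw [lift_gen]
  exact PresentedGroup.mk_surjective k.rels

theorem exists_unique_regular_dessin (k : Index) :
    ∃ D : Dessin.{u}, (D.IsRegular ∧ Nonempty (D.Aut ≃* k.Grp)) ∧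
      ∀ D' : Dessin.{u}, D'.IsRegular → Nonempty (D'.Aut ≃* k.Grp) → D'.IsIso D := by
  have hs := k.lift_gen_surjective
  refine ⟨Dessin.cayley k.genX k.genY hs, ⟨Dessin.cayley_isRegular hs, ?_⟩, ?_⟩
  · obtain ⟨π, hπ, hker⟩ := (Dessin.cayley_isRegular.{u} hs).exists_hom
    exact nonempty_mulEquiv_of_ker π _ hπ hs fun w =>
      (hker w).trans (Dessin.cayley_mono_eq_one_iff hs w)
  · rintro D' hD' ⟨e⟩
    obtain ⟨π, hπ, hker⟩ := hD'.exists_hom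
    obtain ⟨α, hX, hY⟩ := exists_mulEquiv_gen
      (closure_image_of (f := e.toMonoidHom.comp π) (e.surjective.comp hπ))
    have hα : e.toMonoidHom.comp π = α.toMonoidHom.comp (FreeGroup.lift ![k.genX, k.genY]) := by
      apply FreeGroup.ext_hom
      intro i
      fin_cases i
      · simpa using hX.symm
      · simpa using hY.symm
    refine hD'.isIso_of_ker (Dessin.cayley_isRegular hs) fun w => ?_
    rw [Dessin.cayley_mono_eq_one_iff, ← hker]
    have := DFunLike.congr_fun hα w
    simp only [MonoidHom.comp_apply, MulEquiv.toMonoidHom_eq_coe, MonoidHom.coe_coe] at this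
    rw [← e.map_eq_one_iff, this, α.map_eq_one_iff]

end DessinGroup.Index

/-! ### Invariant kernels of the free nilpotent group of class three -/

namespace FreeNilThree

/-- On the first two coordinates, that is on the abelianization, the endomorphism with `X ↦ a` and
`Y ↦ b` is linear. -/
theorem hom_i (a b g : FreeNilThree) :
    ((classThree a b).hom g).i = g.i * a.i + g.j * b.i := by
  let f : FreeNilThree →* Multiplicative ℤ :=
    ⟨⟨fun g => Multiplicative.ofAdd g.i, rfl⟩, fun _ _ => rfl⟩
  have h : f ((classThree a b).hom g) = f a ^ g.i * f b ^ g.j := by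
    obtain ⟨i, j, k, l, m⟩ := g
    simp only [ClassThree.hom_mk, map_mul, map_zpow, map_grpComm, grpComm_eq_one_of_commGroup,
      one_zpow, mul_one]
  have h2 := congrArg Multiplicative.toAdd h
  simpa [f] using h2

theorem hom_j (a b g : FreeNilThree) :
    ((classThree a b).hom g).j = g.i * a.j + g.j * b.j := by
  let f : FreeNilThree →* Multiplicative ℤ :=
    ⟨⟨fun g => Multiplicative.ofAdd g.j, rfl⟩, fun _ _ => rfl⟩
  have h : f ((classThree a b).hom g) = f a ^ g.i * f b ^ g.j := by
    obtain ⟨i, j, k, l, m⟩ := g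
    simp only [ClassThree.hom_mk, map_mul, map_zpow, map_grpComm, grpComm_eq_one_of_commGroup,
      one_zpow, mul_one]
  have h2 := congrArg Multiplicative.toAdd h
  simpa [f] using h2

/-- The image of `X ^ i * Z ^ k * U ^ l * V ^ m` under the endomorphism with `X ↦ a`, `Y ↦ b`, where
`[a, b]` has coordinates `⟨0, 0, d, e, f⟩`. -/
theorem hom_of_j_eq_zero (a b : FreeNilThree) {d e f : ℤ} (h : grpComm a b = ⟨0, 0, d, e, f⟩)
    (i k l m : ℤ) : (classThree a b).hom ⟨i, 0, k, l, m⟩ =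
      a ^ i * ⟨0, 0, k * d, k * e + l * (d * a.i) + m * (d * b.i),
        k * f + l * (d * a.j) + m * (d * b.j)⟩ := by
  rw [ClassThree.hom_mk, h, grpComm_of_derived, grpComm_of_derived,
    zpow_of_i_eq_zero _ _ _ _ (by simp), zpow_of_i_eq_zero _ _ _ _ (by simp),
    zpow_of_i_eq_zero _ _ _ _ (by simp), zpow_zero, mul_one, mul_assoc, mul_assoc]
  congr 1
  ext <;> simp only [mul_def, tri_zero] <;> ring

end FreeNilThree

open FreeNilThree in
/-- A pair of elements of a group such that the five substitutions below, which come from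
automorphisms of the free group of rank two, preserve all relations between `x` and `y`. -/
structure SymmetricPair {G : Type*} [Group G] (x y : G) : Prop extends ClassThree x y where
  shear : ∀ g, toClassThree.hom g = 1 → toClassThree.hom ((classThree X (Y * X)).hom g) = 1
  swap : ∀ g, toClassThree.hom g = 1 → toClassThree.hom ((classThree Y X).hom g) = 1
  invX : ∀ g, toClassThree.hom g = 1 → toClassThree.hom ((classThree X⁻¹ Y).hom g) = 1
  invY : ∀ g, toClassThree.hom g = 1 → toClassThree.hom ((classThree X Y⁻¹).hom g) = 1
  prod : ∀ g, toClassThree.hom g = 1 → toClassThree.hom ((classThree (X * Y) Y).hom g) = 1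

namespace SymmetricPair

open FreeNilThree

variable {G : Type*} [Group G] {x y : G}

/-- Two relations with the same first two coordinates differ by a relation in the derived
subgroup. -/
theorem hom_sub_eq_one (h : SymmetricPair x y) {i j k l m : ℤ} (k' l' m' : ℤ)
    (hg : h.hom ⟨i, j, k, l, m⟩ = 1) (hg' : h.hom ⟨i, j, k', l', m'⟩ = 1) :
    h.hom ⟨0, 0, k - k', l - l', m - m'⟩ = 1 := by
  have e : (⟨0, 0, k - k', l - l', m - m'⟩ : FreeNilThree) =
      (⟨i, j, k', l', m'⟩ : FreeNilThree)⁻¹ * ⟨i, j, k, l, m⟩ := by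
    rw [eq_inv_mul_iff_mul_eq]
    ext <;> simp [mul_def, tri_zero]
  rw [e, map_mul, map_inv, hg, hg', inv_one, mul_one]

theorem conj (h : SymmetricPair x y) {g : FreeNilThree} (hg : h.hom g = 1) (w : FreeNilThree) :
    h.hom (w⁻¹ * g * w) = 1 := by
  simp [hg]

theorem swap_derived (h : SymmetricPair x y) {k l m : ℤ} (hg : h.hom ⟨0, 0, k, l, m⟩ = 1) :
    h.hom ⟨0, 0, -k, -m, -l⟩ = 1 := by
  have := h.swap _ hg
  rw [hom_of_j_eq_zero Y X (d := -1) (e := 0) (f := 0) rfl, zpow_zero, one_mul] at this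
  simpa [X, Y] using this

theorem shear_mk (h : SymmetricPair x y) {i k l m : ℤ} (hg : h.hom ⟨i, 0, k, l, m⟩ = 1) :
    h.hom ⟨i, 0, k, k + l + m, m⟩ = 1 := by
  have := h.shear _ hg
  rw [hom_of_j_eq_zero X (Y * X) (d := 1) (e := 1) (f := 0) rfl, X_zpow] at this
  simpa [X, Y, mul_def, tri_zero] using this

theorem u_zpow_eq_one_iff (h : SymmetricPair x y) (l : ℤ) :
    h.hom ⟨0, 0, 0, l, 0⟩ = 1 ↔ (orderOf (grpComm (grpComm x y) x) : ℤ) ∣ l := by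
  rw [orderOf_dvd_iff_zpow_eq_one]
  simp [ClassThree.hom_mk]

theorem hom_central_eq_one_iff (h : SymmetricPair x y) (l m : ℤ) :
    h.hom ⟨0, 0, 0, l, m⟩ = 1 ↔ (orderOf (grpComm (grpComm x y) x) : ℤ) ∣ l ∧
      (orderOf (grpComm (grpComm x y) x) : ℤ) ∣ m := by
  have key {l m : ℤ} (hg : h.hom ⟨0, 0, 0, l, m⟩ = 1) :
      (orderOf (grpComm (grpComm x y) x) : ℤ) ∣ m := by
    have := h.hom_sub_eq_one 0 l m (h.shear_mk hg) hg
    rw [← h.u_zpow_eq_one_iff]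
    simpa using this
  constructor
  · intro hg
    have := h.swap_derived hg
    rw [neg_zero] at this
    exact ⟨(dvd_neg).1 (key this), key hg⟩
  · rintro ⟨hl, hm⟩
    rw [← h.u_zpow_eq_one_iff] at hl hm
    have := h.swap_derived hm
    rw [neg_zero] at this
    simpa using h.hom_sub_eq_one 0 0 (-m) hl this

/-- The commutator of a relation in the derived subgroup with `X` is a power of `U`. -/
theorem orderOf_u_dvd_of_derived (h : SymmetricPair x y) {k l m : ℤ}
    (hg : h.hom ⟨0, 0, k, l, m⟩ = 1) : (orderOf (grpComm (grpComm x y) x) : ℤ) ∣ k := by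
  have h1 := h.conj hg X
  have e : X⁻¹ * ⟨0, 0, k, l, m⟩ * X = (⟨0, 0, k, l + k, m⟩ : FreeNilThree) := by
    rw [mul_assoc, inv_mul_eq_iff_eq_mul]
    ext <;> simp [mul_def, X, tri_zero]
  rw [e] at h1
  have hk := h.hom_sub_eq_one _ _ _ h1 hg
  simpa [h.u_zpow_eq_one_iff] using hk

/-- The relations inside the derived subgroup are generated by powers of `z`, `u` and `v`. -/
theorem hom_derived_eq_one_iff (h : SymmetricPair x y) (k l m : ℤ) :
    h.hom ⟨0, 0, k, l, m⟩ = 1 ↔ (orderOf (grpComm x y) : ℤ) ∣ k ∧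
      (orderOf (grpComm (grpComm x y) x) : ℤ) ∣ l ∧
      (orderOf (grpComm (grpComm x y) x) : ℤ) ∣ m := by
  have hz (k : ℤ) : h.hom ⟨0, 0, k, 0, 0⟩ = 1 ↔ (orderOf (grpComm x y) : ℤ) ∣ k := by
    rw [orderOf_dvd_iff_zpow_eq_one]
    simp [ClassThree.hom_mk]
  have key {k l m : ℤ} (hg : h.hom ⟨0, 0, k, l, m⟩ = 1) :
      (orderOf (grpComm (grpComm x y) x) : ℤ) ∣ m := by
    have hk := h.orderOf_u_dvd_of_derived hg
    have hkm := h.hom_sub_eq_one _ _ _ (h.shear_mk hg) hg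
    rw [sub_self, sub_self, h.u_zpow_eq_one_iff] at hkm
    exact dvd_trans_eq (hkm.sub hk) (by ring)
  constructor
  · intro hg
    have hl := (dvd_neg).1 (key (h.swap_derived hg))
    have hm := key hg
    refine ⟨?_, hl, hm⟩
    have := h.hom_sub_eq_one _ _ _ hg ((h.hom_central_eq_one_iff l m).2 ⟨hl, hm⟩)
    rw [← hz]
    simpa using this
  · rintro ⟨hk, hl, hm⟩
    have h1 := (hz k).2 hk
    have h2 := (h.hom_central_eq_one_iff (-l) (-m)).2 ⟨hl.neg_right, hm.neg_right⟩
    simpa using h.hom_sub_eq_one _ _ _ h1 h2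

theorem orderOf_u_dvd_orderOf_z (h : SymmetricPair x y) :
    (orderOf (grpComm (grpComm x y) x) : ℤ) ∣ orderOf (grpComm x y) :=
  h.orderOf_u_dvd_of_derived (l := 0) (m := 0)
    ((h.hom_derived_eq_one_iff _ _ _).2 ⟨dvd_rfl, dvd_zero _, dvd_zero _⟩)

/-- The exponents `i` such that `x ^ i` lies in the derived subgroup. -/
def exponents (h : SymmetricPair x y) : AddSubgroup ℤ where
  carrier := {i | ∃ k l m, h.hom ⟨i, 0, k, l, m⟩ = 1}
  zero_mem' := ⟨0, 0, 0, h.hom.map_one⟩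
  add_mem' := by
    rintro a b ⟨k, l, m, ha⟩ ⟨k', l', m', hb⟩
    have : h.hom (⟨a, 0, k, l, m⟩ * ⟨b, 0, k', l', m'⟩) = 1 := by rw [map_mul, ha, hb, one_mul]
    rw [mul_def] at this
    simp only [add_zero] at this
    exact ⟨_, _, _, this⟩
  neg_mem' := by
    rintro a ⟨k, l, m, ha⟩
    have : h.hom (⟨a, 0, k, l, m⟩)⁻¹ = 1 := by rw [map_inv, ha, inv_one]
    rw [inv_def] at this
    simp only [neg_zero] at this
    exact ⟨_, _, _, this⟩

theorem mem_exponents (h : SymmetricPair x y) {i j k l m : ℤ} (hg : h.hom ⟨i, j, k, l, m⟩ = 1) :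
    i ∈ h.exponents ∧ j ∈ h.exponents := by
  have key {g : FreeNilThree} (hg : h.hom g = 1) : g.j ∈ h.exponents := by
    have h1 : h.hom ((classThree X (Y * X)).hom g * g⁻¹) = 1 := by
      rw [map_mul, map_inv, hg, h.shear g hg, inv_one, one_mul]
    obtain ⟨k', l', m', e⟩ : ∃ k' l' m',
        (classThree X (Y * X)).hom g * g⁻¹ = ⟨g.j, 0, k', l', m'⟩ := by
      refine ⟨((classThree X (Y * X)).hom g * g⁻¹).k, ((classThree X (Y * X)).hom g * g⁻¹).l,
        ((classThree X (Y * X)).hom g * g⁻¹).m, ?_⟩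
      ext
      · rw [mul_def, inv_def, hom_i]; simp [X, Y, mul_def]
      · rw [mul_def, inv_def, hom_j]; simp [X, Y, mul_def]
      · rfl
      · rfl
      · rfl
    rw [e] at h1
    exact ⟨k', l', m', h1⟩
  refine ⟨?_, key hg⟩
  have h1 := key (h.swap _ hg)
  rw [hom_j] at h1
  simpa [X, Y] using h1

/-- What the commutator of a relation with `Y` says about its exponents. -/
theorem orderOf_z_dvd (h : SymmetricPair x y) {i k l m : ℤ} (hg : h.hom ⟨i, 0, k, l, m⟩ = 1) :
    (orderOf (grpComm x y) : ℤ) ∣ i ∧ (orderOf (grpComm (grpComm x y) x) : ℤ) ∣ tri i ∧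
      (orderOf (grpComm (grpComm x y) x) : ℤ) ∣ k := by
  have e : Y⁻¹ * ⟨i, 0, k, l, m⟩ * Y = (⟨i, 0, k + i, l + tri i, m + k⟩ : FreeNilThree) := by
    rw [mul_assoc, inv_mul_eq_iff_eq_mul]
    ext <;> simp [mul_def, Y, tri_zero, tri_one]
  have h1 := h.conj hg Y
  rw [e] at h1
  have h2 := h.hom_sub_eq_one _ _ _ h1 hg
  simp only [add_sub_cancel_left] at h2
  exact (h.hom_derived_eq_one_iff _ _ _).1 h2

/-- The relation expressing `x ^ n` through `z` and `u`, and the divisibilities that are forced by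
the symmetries. -/
theorem exists_power_relation (h : SymmetricPair x y) {n : ℕ} (hn : (n : ℤ) ∈ h.exponents) :
    ∃ k l : ℤ, h.hom ⟨n, 0, k, l, 0⟩ = 1 ∧ h.hom ⟨0, n, -k, 0, -l⟩ = 1 ∧
      (orderOf (grpComm x y) : ℤ) ∣ 2 * k ∧
      (orderOf (grpComm (grpComm x y) x) : ℤ) ∣ 2 * l ∧
      (orderOf (grpComm (grpComm x y) x) : ℤ) ∣ n.choose 3 ∧
      (orderOf (grpComm x y) : ℤ) ∣ k - n.choose 2 := by
  obtain ⟨k, l, m, hg⟩ := hn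
  obtain ⟨hBn, -, hCk⟩ := h.orderOf_z_dvd hg
  have hCB := h.orderOf_u_dvd_orderOf_z
  have hm : (orderOf (grpComm (grpComm x y) x) : ℤ) ∣ m := by
    have := h.hom_sub_eq_one _ _ _ (h.shear_mk hg) hg
    simp only [sub_self] at this
    rw [h.u_zpow_eq_one_iff] at this
    exact dvd_trans_eq (this.sub hCk) (by ring)
  have hr : h.hom ⟨n, 0, k, l, 0⟩ = 1 := by
    have h1 := (h.hom_central_eq_one_iff 0 (-m)).2 ⟨dvd_zero _, hm.neg_right⟩
    have e : (⟨n, 0, k, l, 0⟩ : FreeNilThree) = ⟨n, 0, k, l, m⟩ * ⟨0, 0, 0, 0, -m⟩ := by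
      ext <;> simp [mul_def, tri_zero]
    rw [e, map_mul, hg, h1, one_mul]
  have hs : h.hom ⟨0, n, -k, 0, -l⟩ = 1 := by
    have := h.swap _ hr
    rw [hom_of_j_eq_zero Y X (d := -1) (e := 0) (f := 0) rfl, Y_zpow] at this
    simpa [X, Y, mul_def, tri_zero] using this
  refine ⟨k, l, hr, hs, ?_, ?_, ?_⟩
  -- Inverting `Y` inverts `z` and `u` up to factors `v`.
  · have h1 := h.invY _ hr
    rw [hom_of_j_eq_zero X Y⁻¹ (d := -1) (e := 0) (f := 1) rfl, X_zpow] at h1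
    simp only [X, Y, mul_def, inv_def, tri_zero] at h1
    simp at h1
    have h2 := ((h.hom_derived_eq_one_iff _ _ _).1 (h.hom_sub_eq_one _ _ _ hr h1)).1
    exact dvd_trans_eq h2 (by ring)
  -- Inverting `X` inverts `x ^ n` and `z`, but fixes `u`.
  · have h1 := h.invX _ hr
    rw [hom_of_j_eq_zero X⁻¹ Y (d := -1) (e := 1) (f := 0) rfl, inv_zpow', X_zpow] at h1
    have h2 : h.hom (⟨n, 0, k, l, 0⟩ * (⟨-n, 0, 0, 0, 0⟩ * ⟨0, 0, k * -1,
        k * 1 + l * (-1 * X⁻¹.i) + 0 * (-1 * Y.i), k * 0 + l * (-1 * X⁻¹.j) + 0 * (-1 * Y.j)⟩)) =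
        1 := by
      rw [map_mul, hr, h1, one_mul]
    simp only [X, Y, mul_def, inv_def, tri_zero] at h2
    simp at h2
    have h3 := ((h.hom_derived_eq_one_iff _ _ _).1 h2).2.1
    exact dvd_trans_eq ((h3.sub hCk).add ((hCB.trans hBn).mul_right k)) (by ring)
  -- The `n`-th power of `X * Y`, computed by the symmetry and by the power formula.
  · have h1 := h.prod _ hr
    rw [hom_of_j_eq_zero (X * Y) Y (d := 1) (e := 0) (f := 1) rfl, zpow_natCast, pow_def] at h1
    simp only [X, Y, mul_def, tri_zero] at h1
    have h2 : h.hom (⟨n, 0, k, l, 0⟩ * ⟨0, n, -k, 0, -l⟩) = 1 := by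
      rw [map_mul, hr, hs, one_mul]
    simp only [mul_def, tri_zero] at h2
    simp [tri_one] at h1 h2
    have h3 := (h.hom_derived_eq_one_iff _ _ _).1 (h.hom_sub_eq_one _ _ _ h1 h2)
    exact ⟨dvd_trans_eq h3.2.1.neg_right (by ring), dvd_trans_eq h3.1 (by ring)⟩

end SymmetricPair

/-! ### Totally symmetric groups of class three -/

theorem ClassThree.of_nilpotencyClass {G : Type*} [Group G] [Group.IsNilpotent G]
    (hG : Group.nilpotencyClass G = 3) (x y : G) : ClassThree x y := by
  have h3 : (⊤ : Subgroup G).lowerCentralSeries 3 = ⊥ :=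
    Subgroup.lowerCentralSeries_eq_bot_iff_nilpotencyClass_le.2 hG.le
  have key (g h : G) : Commute g (grpComm (grpComm x y) h) := by
    have h1 : grpComm (grpComm (grpComm x y) h) g ∈ (⊤ : Subgroup G).lowerCentralSeries 3 :=
      grpComm_mem_commutator (grpComm_mem_commutator (grpComm_mem_commutator
        (Subgroup.mem_top _) (Subgroup.mem_top _)) (Subgroup.mem_top _)) (Subgroup.mem_top _)
    rw [h3, Subgroup.mem_bot, grpComm_eq_one_iff] at h1
    exact h1.symm
  exact ⟨key _ _, key _ _, key _ _, key _ _⟩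

open scoped commutatorElement in
open FreeNilThree in
/-- If the elements `U` and `V` of the free nilpotent group act trivially, the class is at
most two. -/
theorem ClassThree.nilpotencyClass_le_two {G : Type*} [Group G] [Group.IsNilpotent G] {x y : G}
    (h : ClassThree x y) (hs : Function.Surjective h.hom)
    (h1 : ∀ l m, h.hom ⟨0, 0, 0, l, m⟩ = 1) : Group.nilpotencyClass G ≤ 2 := by
  rw [← Subgroup.lowerCentralSeries_eq_bot_iff_nilpotencyClass_le, eq_bot_iff]
  have hc : ⁅(⊤ : Subgroup G), ⊤⁆ ≤ Subgroup.center G := by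
    rw [Subgroup.commutator_le]
    intro g _ g' _
    obtain ⟨a, rfl⟩ := hs g
    obtain ⟨a', rfl⟩ := hs g'
    rw [Subgroup.mem_center_iff]
    intro w
    obtain ⟨b, rfl⟩ := hs w
    obtain ⟨l, m, e⟩ := grpComm_def a⁻¹ a'⁻¹
    have e' : ⁅h.hom a, h.hom a'⁆ = h.hom (grpComm a⁻¹ a'⁻¹) := by
      simp [commutatorElement_def, grpComm]
    rw [e', e]
    generalize a⁻¹.i * a'⁻¹.j - a'⁻¹.i * a⁻¹.j = d
    have h2 := h1 (d * b.i) (d * b.j)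
    rw [← grpComm_of_derived d l m b, map_grpComm, grpComm_eq_one_iff] at h2
    exact h2.eq.symm
  change ⁅⁅(⊤ : Subgroup G), ⊤⁆, ⊤⁆ ≤ ⊥
  rw [Subgroup.commutator_le]
  intro g hg w _
  rw [Subgroup.mem_bot, commutatorElement_eq_one_iff_mul_comm]
  exact (Subgroup.mem_center_iff.1 (hc hg) w).symm

/-- The automorphism of the free group of rank two given by two mutually inverse substitutions. -/
def freeAut (a b c d : F2) (h0 : FreeGroup.lift ![c, d] a = FreeGroup.of 0)
    (h1 : FreeGroup.lift ![c, d] b = FreeGroup.of 1)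
    (h2 : FreeGroup.lift ![a, b] c = FreeGroup.of 0)
    (h3 : FreeGroup.lift ![a, b] d = FreeGroup.of 1) : F2 ≃* F2 :=
  MonoidHom.toMulEquiv (FreeGroup.lift ![a, b]) (FreeGroup.lift ![c, d])
    (by apply FreeGroup.ext_hom; intro i; fin_cases i <;> simp [h0, h1])
    (by apply FreeGroup.ext_hom; intro i; fin_cases i <;> simp [h2, h3])

open FreeNilThree in
/-- If the kernel of `π` is invariant under the automorphisms of the free group, then the relations
in the free nilpotent group are preserved by the endomorphisms which these automorphisms induce. -/
theorem ClassThree.hom_comp_eq_one {G : Type*} [Group G] {π : F2 →* G}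
    (h : ClassThree (π (FreeGroup.of 0)) (π (FreeGroup.of 1)))
    (hinv : ∀ (σ : F2 ≃* F2) (w : F2), π w = 1 → π (σ w) = 1) (σ : F2 ≃* F2)
    (g : FreeNilThree) (hg : h.hom g = 1) :
    h.hom ((classThree (FreeGroup.lift ![X, Y] (σ (FreeGroup.of 0)))
      (FreeGroup.lift ![X, Y] (σ (FreeGroup.of 1)))).hom g) = 1 := by
  have hq : Function.Surjective (FreeGroup.lift ![X, Y] : F2 →* FreeNilThree) := by
    rw [← MonoidHom.range_eq_top, eq_top_iff, ← closure_X_Y, Subgroup.closure_le]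
    rintro _ (rfl | rfl)
    exacts [⟨FreeGroup.of 0, by simp⟩, ⟨FreeGroup.of 1, by simp⟩]
  have e1 : h.hom.comp (FreeGroup.lift ![X, Y]) = π := by
    apply FreeGroup.ext_hom
    intro i
    fin_cases i
    · simp [h.hom_X]
    · simp [h.hom_Y]
  have e2 : (classThree (FreeGroup.lift ![X, Y] (σ (FreeGroup.of 0)))
      (FreeGroup.lift ![X, Y] (σ (FreeGroup.of 1)))).hom.comp (FreeGroup.lift ![X, Y]) =
      (FreeGroup.lift ![X, Y]).comp σ.toMonoidHom := by
    apply FreeGroup.ext_hom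
    intro i
    fin_cases i
    · simp [hom_X]
    · simp [hom_Y]
  obtain ⟨w, rfl⟩ := hq g
  have h1 := DFunLike.congr_fun e2 w
  rw [MonoidHom.comp_apply] at h1
  rw [h1, ← MonoidHom.comp_apply, ← MonoidHom.comp_assoc, e1]
  rw [← MonoidHom.comp_apply, e1] at hg
  exact hinv σ w hg

theorem symmetricPair_of_invariant {G : Type*} [Group G] {π : F2 →* G}
    (h : ClassThree (π (FreeGroup.of 0)) (π (FreeGroup.of 1)))
    (hinv : ∀ (σ : F2 ≃* F2) (w : F2), π w = 1 → π (σ w) = 1) :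
    SymmetricPair (π (FreeGroup.of 0)) (π (FreeGroup.of 1)) := by
  let a : F2 := FreeGroup.of 0
  let b : F2 := FreeGroup.of 1
  have key := h.hom_comp_eq_one hinv
  refine ⟨h, ?_, ?_, ?_, ?_, ?_⟩
  · simpa [freeAut, a, b] using key (freeAut a (b * a) a (b * a⁻¹)
      (by simp [a]) (by simp [a, b]) (by simp [a]) (by simp [a, b]))
  · simpa [freeAut, a, b] using key (freeAut b a b a
      (by simp [a, b]) (by simp [a, b]) (by simp [a, b]) (by simp [a, b]))
  · simpa [freeAut, a, b] using key (freeAut a⁻¹ b a⁻¹ b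
      (by simp [a]) (by simp [b]) (by simp [a]) (by simp [b]))
  · simpa [freeAut, a, b] using key (freeAut a b⁻¹ a b⁻¹
      (by simp [a]) (by simp [b]) (by simp [a]) (by simp [b]))
  · simpa [freeAut, a, b] using key (freeAut (a * b) b (a * b⁻¹) b
      (by simp [a, b]) (by simp [b]) (by simp [a, b]) (by simp [b]))

theorem odd_of_dvd_choose_two {n : ℕ} (hn : n ≠ 0) (h : n ∣ n.choose 2) : Odd n := by
  obtain ⟨w, hw⟩ := h
  have h2 := two_mul_tri n
  rw [tri_natCast, hw] at h2
  have h3 : (2 * w : ℤ) = n - 1 := by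
    apply mul_left_cancel₀ (show (n : ℤ) ≠ 0 by exact_mod_cast hn)
    push_cast at h2
    linarith
  exact ⟨w, by omega⟩

theorem not_three_dvd_of_dvd_choose_three {n : ℕ} (hn : n ≠ 0) (h : n ∣ n.choose 3) :
    ¬ 3 ∣ n := by
  obtain ⟨w, hw⟩ := h
  obtain ⟨N, rfl⟩ := Nat.exists_eq_succ_of_ne_zero hn
  have h1 := Nat.add_one_mul_choose_eq N 2
  rw [Nat.succ_eq_add_one] at hw
  rw [hw, mul_assoc] at h1
  have h2 : N.choose 2 = w * 3 := Nat.eq_of_mul_eq_mul_left N.succ_pos h1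
  have h3 := two_mul_tri N
  rw [tri_natCast, h2] at h3
  rintro ⟨t, ht⟩
  have hN : (N : ℤ) = 3 * t - 1 := by omega
  rw [hN] at h3
  ring_nf at h3
  push_cast at h3
  omega

/-- If `2 * k` is divisible by `p ^ b`, then `k` is congruent to a multiple of `p ^ (b - 1)` by `0`
or `1`, and to `0` if `p` is odd. -/
theorem exists_half_period {p b : ℕ} (hp : p.Prime) (hb : 1 ≤ b) {k : ℤ}
    (h : ((p ^ b : ℕ) : ℤ) ∣ 2 * k) :
    ∃ ε : ℕ, ε ≤ 1 ∧ (p ≠ 2 → ε = 0) ∧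
      ((p ^ b : ℕ) : ℤ) ∣ k + ((ε * p ^ (b - 1) : ℕ) : ℤ) := by
  by_cases hp2 : p = 2
  · obtain rfl := hp2
    obtain ⟨b, rfl⟩ := Nat.exists_eq_add_of_le' hb
    rw [Nat.add_sub_cancel, pow_succ'] at *
    push_cast at h ⊢
    obtain ⟨w, rfl⟩ := Int.dvd_of_mul_dvd_mul_left two_ne_zero h
    rcases Int.even_or_odd' w with ⟨r, rfl | rfl⟩
    · exact ⟨0, by simp, by simp, r, by push_cast; ring⟩
    · exact ⟨1, by simp, by simp, r + 1, by push_cast; ring⟩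
  · refine ⟨0, by simp, by simp, ?_⟩
    have hc : IsCoprime ((p ^ b : ℕ) : ℤ) 2 := by
      exact_mod_cast (Nat.isCoprime_iff_coprime (m := p ^ b) (n := 2)).2
        (Nat.Coprime.pow_left b ((Nat.coprime_primes hp Nat.prime_two).2 hp2))
    simpa using hc.dvd_of_dvd_mul_left h

namespace SymmetricPair

variable {G : Type*} [Group G] {x y : G}

/-- A symmetric generating pair of a `p`-group of class exactly three satisfies the power relations
for valid parameters, and all its relations follow from these. -/
theorem exists_params (h : SymmetricPair x y) {p : ℕ} (hp : p.Prime) (hG : IsPGroup p G)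
    (hu : grpComm (grpComm x y) x ≠ 1) :
    ∃ P : PowerParams, P.p = p ∧ P.Valid ∧ P.Rel x y ∧ ∀ g : FreeNilThree, h.hom g = 1 →
      IsRelation (P.p ^ P.α) (P.p ^ P.b) (P.p ^ P.c) (P.ε * P.p ^ (P.b - 1))
        (P.δ * P.p ^ (P.c - 1)) g := by
  have := Fact.mk hp
  obtain ⟨b, hb⟩ := IsPGroup.iff_orderOf.1 hG (grpComm x y)
  obtain ⟨c, hc⟩ := IsPGroup.iff_orderOf.1 hG (grpComm (grpComm x y) x)
  obtain ⟨α, hα⟩ : ∃ α, ∀ i, i ∈ h.exponents ↔ ((p ^ α : ℕ) : ℤ) ∣ i := by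
    obtain ⟨d, hd⟩ := Int.subgroup_cyclic h.exponents
    have hmem (i : ℤ) : i ∈ h.exponents ↔ d ∣ i := by
      rw [hd, ← AddSubgroup.zmultiples_eq_closure, Int.mem_zmultiples_iff]
    obtain ⟨a, ha⟩ := IsPGroup.iff_orderOf.1 hG x
    have h1 : ((p ^ a : ℕ) : ℤ) ∈ h.exponents := by
      refine ⟨0, 0, 0, ?_⟩
      rw [ClassThree.hom_mk, zpow_natCast, ← ha, pow_orderOf_eq_one]
      simp
    rw [hmem, ← Int.natAbs_dvd, Int.natCast_dvd_natCast, Nat.dvd_prime_pow hp] at h1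
    obtain ⟨α, -, hα⟩ := h1
    exact ⟨α, fun i => by rw [hmem, ← hα, Int.natAbs_dvd]⟩
  have hc1 : 1 ≤ c := by
    rw [Nat.one_le_iff_ne_zero]
    rintro rfl
    exact hu (orderOf_eq_one_iff.1 (by simpa using hc))
  have hder := h.hom_derived_eq_one_iff
  have hCB := h.orderOf_u_dvd_orderOf_z
  obtain ⟨k, l, hr, hs, hk, hl, hC3, hBk⟩ := h.exists_power_relation ((hα _).2 dvd_rfl)
  obtain ⟨hBn, hC2, -⟩ := h.orderOf_z_dvd hr
  rw [tri_natCast] at hC2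
  rw [hb, hc] at hder hCB
  rw [hb] at hk hBn hBk
  rw [hc] at hl hC2 hC3
  rw [Int.natCast_dvd_natCast] at hCB hBn hC2 hC3
  have hcb := (Nat.pow_dvd_pow_iff_le_right hp.one_lt).1 hCB
  have hbα := (Nat.pow_dvd_pow_iff_le_right hp.one_lt).1 hBn
  have hb1 := hc1.trans hcb
  have hn0 : p ^ α ≠ 0 := pow_ne_zero _ hp.ne_zero
  have hpn : p ∣ p ^ α := dvd_pow_self p (by omega)
  obtain ⟨ε, hε, hε2, hεk⟩ := exists_half_period hp hb1 hk
  obtain ⟨δ, hδ, hδ2, hδl⟩ := exists_half_period hp hc1 hl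
  have hrel : PowerParams.Rel ⟨p, α, b, c, ε, δ⟩ x y := by
    set κ := ε * p ^ (b - 1)
    set μ := δ * p ^ (c - 1)
    have hv : h.hom ⟨0, 0, 0, 0, (p ^ c : ℕ)⟩ = 1 :=
      (hder _ _ _).2 ⟨dvd_zero _, dvd_zero _, dvd_rfl⟩
    refine ⟨h.toClassThree, ?_, ?_, ?_, ?_, ?_⟩
    · rw [← hb, pow_orderOf_eq_one]
    · rw [← hc, pow_orderOf_eq_one]
    · rw [ClassThree.hom_mk, zpow_natCast] at hv
      simpa using hv
    · have h1 := (hder (k + κ) (l + μ) 0).2 ⟨hεk, hδl, dvd_zero _⟩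
      have e : (⟨0, 0, k + κ, l + μ, 0⟩ : FreeNilThree) =
          ⟨0, 0, κ, μ, 0⟩ * ⟨0, 0, k, l, 0⟩ := by
        ext <;> simp [FreeNilThree.mul_def, tri_zero, add_comm]
      have e2 : (⟨(p ^ α : ℕ), 0, k, l, 0⟩ : FreeNilThree) =
          ⟨(p ^ α : ℕ), 0, 0, 0, 0⟩ * ⟨0, 0, k, l, 0⟩ := by
        ext <;> simp [FreeNilThree.mul_def, tri_zero]
      rw [e2, ← h1, e, map_mul, map_mul] at hr
      have h3 := mul_right_cancel hr
      rw [ClassThree.hom_mk, ClassThree.hom_mk] at h3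
      simpa only [zpow_natCast, zpow_zero, mul_one, one_mul] using h3
    · have h1 := (hder (-k + κ) 0 (-l + μ)).2
        ⟨dvd_trans_eq (hεk.sub hk) (by ring), dvd_zero _, dvd_trans_eq (hδl.sub hl) (by ring)⟩
      have e : (⟨0, 0, -k + κ, 0, -l + μ⟩ : FreeNilThree) =
          ⟨0, 0, κ, 0, μ⟩ * ⟨0, 0, -k, 0, -l⟩ := by
        ext <;> simp [FreeNilThree.mul_def, tri_zero, add_comm]
      have e2 : (⟨0, (p ^ α : ℕ), -k, 0, -l⟩ : FreeNilThree) =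
          ⟨0, (p ^ α : ℕ), 0, 0, 0⟩ * ⟨0, 0, -k, 0, -l⟩ := by
        ext <;> simp [FreeNilThree.mul_def, tri_zero]
      rw [e2, ← h1, e, map_mul, map_mul] at hs
      have h3 := mul_right_cancel hs
      rw [ClassThree.hom_mk, ClassThree.hom_mk] at h3
      simpa only [zpow_natCast, zpow_zero, mul_one, one_mul] using h3
  have hvalid : PowerParams.Valid ⟨p, α, b, c, ε, δ⟩ := by
    refine ⟨hp, hc1, hcb, hbα, hε, hδ, fun h2 => ⟨hε2 h2, hδ2 h2⟩, ?_, ?_⟩ <;> dsimp only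
    · rintro rfl
      refine lt_of_le_of_ne (hcb.trans hbα) fun hcα => ?_
      rw [hcα] at hC3
      exact not_three_dvd_of_dvd_choose_three hn0 hC3 hpn
    · rintro rfl
      refine ⟨lt_of_le_of_ne (hcb.trans hbα) fun hcα => ?_, ?_, ?_⟩
      · rw [hcα] at hC2
        exact Nat.not_odd_iff_even.2 (even_iff_two_dvd.2 hpn) (odd_of_dvd_choose_two hn0 hC2)
      -- For `ε = 0` the order of `z` divides `n choose 2`, which `n` itself does not.
      · rintro rfl
        refine lt_of_le_of_ne hbα fun hb' => ?_
        have h1 := dvd_trans_eq (hεk.sub hBk)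
          (show _ = (((2 ^ α).choose 2 : ℕ) : ℤ) by push_cast; ring)
        rw [Int.natCast_dvd_natCast, hb'] at h1
        exact Nat.not_odd_iff_even.2 (even_iff_two_dvd.2 hpn) (odd_of_dvd_choose_two hn0 h1)
      -- For `b < α` the order of `z` divides `n choose 2`, and hence the exponent of `z`.
      · rintro rfl
        by_contra hb'
        have h1 := Int.natCast_dvd_natCast.2
          (pow_dvd_choose hp Nat.prime_two hbα fun _ => lt_of_le_of_ne hbα hb')
        have h2 := dvd_trans_eq (hεk.sub (hBk.add h1))
          (show _ = ((2 ^ (b - 1) : ℕ) : ℤ) by push_cast; ring)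
        rw [Int.natCast_dvd_natCast, Nat.pow_dvd_pow_iff_le_right hp.one_lt] at h2
        omega
  refine ⟨⟨p, α, b, c, ε, δ⟩, rfl, hvalid, hrel, ?_⟩
  rintro ⟨i, j, k', l', m'⟩ hg
  obtain ⟨hi, hj⟩ := h.mem_exponents hg
  obtain ⟨s, rfl⟩ := (hα i).1 hi
  obtain ⟨t, rfl⟩ := (hα j).1 hj
  have h1 := hrel.hom_eq_one (g := ⟨(p ^ α : ℕ) * s, (p ^ α : ℕ) * t,
    -((ε * p ^ (b - 1) : ℕ) * (s + t)), -((δ * p ^ (c - 1) : ℕ) * s),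
    -((δ * p ^ (c - 1) : ℕ) * t)⟩) ⟨s, t, rfl, rfl, by simp, by simp, by simp⟩
  obtain ⟨h2, h3, h4⟩ := (hder _ _ _).1 (h.hom_sub_eq_one _ _ _ hg h1)
  exact ⟨s, t, rfl, rfl, dvd_trans_eq h2 (by ring), dvd_trans_eq h3 (by ring),
    dvd_trans_eq h4 (by ring)⟩

end SymmetricPair

open DessinGroup.Index in
/-- A `p`-group of class three which is the quotient of the free group of rank two by an
automorphism invariant subgroup belongs to one of the six families. -/
theorem exists_index_of_invariant {G : Type*} [Group G] [Group.IsNilpotent G] {p : ℕ}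
    (hp : p.Prime) (hG : IsPGroup p G) (hclass : Group.nilpotencyClass G = 3) {π : F2 →* G}
    (hπ : Function.Surjective π) (hinv : ∀ (σ : F2 ≃* F2) (w : F2), π w = 1 → π (σ w) = 1) :
    ∃ k : DessinGroup.Index, k.prime = p ∧ Nonempty (G ≃* k.Grp) := by
  have h := symmetricPair_of_invariant (ClassThree.of_nilpotencyClass hclass _ _) hinv
  have hgen := closure_image_of hπ
  have hu : grpComm (grpComm (π (FreeGroup.of 0)) (π (FreeGroup.of 1)))
      (π (FreeGroup.of 0)) ≠ 1 := by
    intro hu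
    have := h.nilpotencyClass_le_two (h.hom_surjective hgen) fun l m => by
      rw [h.hom_central_eq_one_iff, hu, orderOf_one]
      simp
    omega
  obtain ⟨P, rfl, hP, hrel, hker⟩ := h.exists_params hp hG hu
  obtain ⟨k, rfl⟩ := exists_params_eq hP
  refine ⟨k, k.params_p.symm, ⟨(MulEquiv.ofBijective (toGroup hrel)
    ⟨?_, toGroup_surjective hrel hgen⟩).symm⟩⟩
  rw [injective_iff_map_eq_one]
  intro w hw
  obtain ⟨g, rfl⟩ := k.rel_gen.hom_surjective k.closure_gen w
  have e : (toGroup hrel).comp k.rel_gen.hom = h.hom := by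
    apply FreeNilThree.hom_ext
    · simp [ClassThree.hom_X, toGroup_genX]
    · simp [ClassThree.hom_Y, toGroup_genY]
  rw [hom_gen_eq_one_iff]
  apply hker
  rw [← e]
  exact hw

/-- For a totally symmetric dessin, the kernel of the monodromy representation is invariant under
all automorphisms of the free group. -/
theorem Dessin.IsTotallySymmetric.mono_eq_one {D : Dessin.{u}} (hD : D.IsTotallySymmetric)
    (σ : F2 ≃* F2) {w : F2} (hw : D.mono w = 1) : D.mono (σ w) = 1 := by
  rw [← (hD.2 σ).mono_eq_one_iff]
  have := monodromy_comp D.ρ D.lam σ (σ w)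
  rw [σ.symm_apply_apply] at this
  exact this.trans hw

theorem theorem5p1 :
    -- the automorphism group of a totally symmetric dessin that is a `p`-group of class three
    -- belongs to one of the six families
    (∀ (p : ℕ) (D : Dessin.{u}), p.Prime → D.IsTotallySymmetric → IsPGroup p D.Aut →
      Group.IsNilpotent D.Aut → Group.nilpotencyClass D.Aut = 3 →
      ∃ k : DessinGroup.Index, k.prime = p ∧ Nonempty (D.Aut ≃* k.Grp)) ∧
    -- each of the groups underlies a unique regular dessin
    (∀ k : DessinGroup.Index, ∃ D : Dessin.{u},
      (D.IsRegular ∧ Nonempty (D.Aut ≃* k.Grp)) ∧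
      ∀ D' : Dessin.{u}, D'.IsRegular → Nonempty (D'.Aut ≃* k.Grp) → D'.IsIso D) ∧
    -- the automorphism group of each of the groups is transitive on generating pairs
    (∀ (k : DessinGroup.Index) (g h g' h' : k.Grp),
      Subgroup.closure {g, h} = ⊤ → Subgroup.closure {g', h'} = ⊤ →
      ∃ α : k.Grp ≃* k.Grp, α g = g' ∧ α h = h') ∧
    -- distinct families or distinct parameters give non-isomorphic groups
    (∀ k l : DessinGroup.Index, Nonempty (k.Grp ≃* l.Grp) → k = l) := by
  refine ⟨?_, DessinGroup.Index.exists_unique_regular_dessin,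
    fun k g h g' h' => DessinGroup.Index.exists_mulEquiv,
    fun k l ⟨e⟩ => DessinGroup.Index.eq_of_mulEquiv e⟩
  intro p D hp hD hG hnil hclass
  obtain ⟨π, hπ, hker⟩ := hD.1.exists_hom
  refine exists_index_of_invariant hp hG hclass hπ fun σ w hw => ?_
  rw [hker] at hw ⊢
  exact hD.mono_eq_one σ hw
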